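/- For $n\ge 1$ let $G_n$ be the graph with vertex set $\{0,1/n,2/n,\dots,1\}$ and edges $\{(j-1)/n,\,j/n\}$, $j=1,\dots,n$, and write $S^n_j$ for the spin at the vertex $j/n$, a unit vector in $\mathbb{R}^2=\mathbb{C}$. Consider the XY model on $G_n$ with free boundary conditions at inverse temperature $\mathcal{B}_n\in\mathbb{R}$, that is, let $(S^n_0,\dots,S^n_n)$ be distributed according to the Gibbs measure $$Z_n^{-1}\exp\Big(\mathcal{B}_n\sum_{j=1}^n S^n_{j-1}\cdot S^n_j\Big)\prod_{j=0}^n dS^n_j ,$$ where $dS$ is arc length on the unit circle $\mathbb{S}^1$ and $Z_n$ is the normalizing constant. Suppose that $\mathcal{B}_n/n\to b\in(0,\infty)$ as $n\to\infty$. Then the random càdlàg paths $\big(S^n_{\lfloor nt\rfloor}\big)_{t\in[0,1]}$ converge in distribution, in the space $D([0,1],\mathbb{S}^1)$ with the Skorohod ($J_1$) metric, to $S(t)=(\cos\Phi(t),\sin\Phi(t))=e^{i\Phi(t)}$, $t\in[0,1]$, where $S$ has càdlàg paths, $\Phi(0)$ is uniformly distributed on $[-\pi,\pi)$, the process $\big(e^{i(\Phi(t)-\Phi(0))}\big)_{t\in[0,1]}$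 is independent of $\Phi(0)$, and this process has the same distribution as $\big(e^{iB(t)/\sqrt b}\big)_{t\in[0,1]}$ for a standard one-dimensional Brownian motion $B$. -/

import Mathlib

open MeasureTheory ProbabilityTheory Filter Set
open scoped Topology ENNReal unitInterval

noncomputable section

/-- A càdlàg path on `[0,1]` with values in `E`: right-continuous with left limits. -/
structure CadlagPath (E : Type*) [TopologicalSpace E] where
  /-- the underlying function -/
  toFun : I → E
  right_continuous : ∀ t : I, ContinuousWithinAt toFun (Ici t) t
  left_limit : ∀ t : I, ∃ l : E, Tendsto toFun (𝓝[<] t) (𝓝 l)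

namespace CadlagPath

instance {E : Type*} [TopologicalSpace E] : CoeFun (CadlagPath E) (fun _ => I → E) :=
  ⟨CadlagPath.toFun⟩

/-- The Skorohod (`J₁`) distance
`d(x, y) = inf_φ max (sup_t |φ(t) - t|, sup_t d(x(t), y(φ(t))))`,
where `φ` runs over the increasing bijections of `[0,1]`. -/
def skorohodEDist {E : Type*} [PseudoEMetricSpace E] (x y : CadlagPath E) : ℝ≥0∞ :=
  ⨅ φ : I ≃o I, max (⨆ t : I, edist (φ t) t) (⨆ t : I, edist (x t) (y (φ t)))

theorem skorohodEDist_comm_le {E : Type*} [PseudoEMetricSpace E] (x y : CadlagPath E) :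
    skorohodEDist y x ≤ skorohodEDist x y := by
  refine le_iInf fun φ => (iInf_le _ φ.symm).trans (max_le_max ?_ ?_)
  · refine iSup_le fun t => ?_
    have := le_iSup (fun t : I => edist (φ t) t) (φ.symm t)
    simpa [edist_comm] using this
  · refine iSup_le fun t => ?_
    have := le_iSup (fun t : I => edist (x t) (y (φ t))) (φ.symm t)
    simpa [edist_comm] using this

theorem skorohodEDist_triangle {E : Type*} [PseudoEMetricSpace E] (x y z : CadlagPath E) :
    skorohodEDist x z ≤ skorohodEDist x y + skorohodEDist y z := by
  refine ENNReal.le_iInf_add_iInf fun φ ψ => (iInf_le _ (φ.trans ψ)).trans (max_le ?_ ?_)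
  · refine iSup_le fun t => ?_
    calc edist (ψ (φ t)) t ≤ edist (φ t) t + edist (ψ (φ t)) (φ t) := by
          rw [add_comm]; exact edist_triangle _ _ _
      _ ≤ _ := add_le_add
          ((le_iSup (fun t : I => edist (φ t) t) t).trans (le_max_left _ _))
          ((le_iSup (fun t : I => edist (ψ t) t) (φ t)).trans (le_max_left _ _))
  · refine iSup_le fun t => ?_
    calc edist (x t) (z (ψ (φ t))) ≤ edist (x t) (y (φ t)) + edist (y (φ t)) (z (ψ (φ t))) :=
          edist_triangle _ _ _
      _ ≤ _ := add_le_add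
          ((le_iSup (fun t : I => edist (x t) (y (φ t))) t).trans (le_max_right _ _))
          ((le_iSup (fun t : I => edist (y t) (z (ψ t))) (φ t)).trans (le_max_right _ _))

/-- The Skorohod space `D([0,1], E)` carries the Skorohod distance and its topology. -/
instance {E : Type*} [PseudoEMetricSpace E] : PseudoEMetricSpace (CadlagPath E) where
  edist := skorohodEDist
  edist_self x := by
    refine le_antisymm ((iInf_le _ (OrderIso.refl I)).trans ?_) zero_le
    simp
  edist_comm x y := le_antisymm (skorohodEDist_comm_le y x) (skorohodEDist_comm_le x y)
  edist_triangle := skorohodEDist_triangle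

instance {E : Type*} [PseudoEMetricSpace E] : MeasurableSpace (CadlagPath E) :=
  borel (CadlagPath E)

instance {E : Type*} [PseudoEMetricSpace E] : BorelSpace (CadlagPath E) := ⟨rfl⟩

end CadlagPath

/-- The unit circle carries its Borel σ-algebra. -/
instance : MeasurableSpace Circle := borel Circle

instance : BorelSpace Circle := ⟨rfl⟩

namespace XYChain

/-- The vertex `⌊n t⌋` of the chain `0, 1, …, n` (vertex `j` sits at the point `j / n`). -/
def site (n : ℕ) (t : I) : Fin (n + 1) :=
  ⟨⌊(n : ℝ) * (t : ℝ)⌋₊, Nat.lt_succ_of_le (Nat.floor_le_of_le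
    (mul_le_of_le_one_right n.cast_nonneg t.2.2))⟩

theorem site_eventually_right (n : ℕ) (t : I) : ∀ᶠ s in 𝓝[≥] t, site n s = site n t := by
  have hc : Continuous fun s : I => (n : ℝ) * (s : ℝ) := by fun_prop
  have h1 : ∀ᶠ s : I in 𝓝[≥] t, (n : ℝ) * (s : ℝ) < ⌊(n : ℝ) * (t : ℝ)⌋₊ + 1 :=
    (hc.continuousAt.eventually_lt continuousAt_const (Nat.lt_floor_add_one _)).filter_mono
      nhdsWithin_le_nhds
  filter_upwards [h1, self_mem_nhdsWithin] with s hs hts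
  refine Fin.ext ((Nat.floor_eq_iff (mul_nonneg n.cast_nonneg s.2.1)).2 ⟨?_, hs⟩)
  exact (Nat.floor_le (mul_nonneg n.cast_nonneg t.2.1)).trans
    (mul_le_mul_of_nonneg_left hts n.cast_nonneg)

theorem site_eventually_left (n : ℕ) (t : I) :
    ∃ j : Fin (n + 1), ∀ᶠ s in 𝓝[<] t, site n s = j := by
  have hc : Continuous fun s : I => (n : ℝ) * (s : ℝ) := by fun_prop
  by_cases h : 0 < (n : ℝ) * (t : ℝ)
  · have hn : (0 : ℝ) < n := by
      by_contra h0
      have : (n : ℝ) = 0 := le_antisymm (not_lt.1 h0) n.cast_nonneg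
      simp [this] at h
    have hceil : 1 ≤ ⌈(n : ℝ) * (t : ℝ)⌉₊ := Nat.ceil_pos.2 h
    have hle : ⌈(n : ℝ) * (t : ℝ)⌉₊ ≤ n :=
      Nat.ceil_le.2 (mul_le_of_le_one_right n.cast_nonneg t.2.2)
    have hlt : ((⌈(n : ℝ) * (t : ℝ)⌉₊ - 1 : ℕ) : ℝ) < (n : ℝ) * (t : ℝ) :=
      Nat.lt_ceil.1 (by omega)
    refine ⟨⟨⌈(n : ℝ) * (t : ℝ)⌉₊ - 1, by omega⟩, ?_⟩
    have h1 : ∀ᶠ s : I in 𝓝[<] t, ((⌈(n : ℝ) * (t : ℝ)⌉₊ - 1 : ℕ) : ℝ) < (n : ℝ) * (s : ℝ) :=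
      (continuousAt_const.eventually_lt hc.continuousAt hlt).filter_mono nhdsWithin_le_nhds
    filter_upwards [h1, self_mem_nhdsWithin] with s hs hst
    refine Fin.ext ((Nat.floor_eq_iff (mul_nonneg n.cast_nonneg s.2.1)).2 ⟨hs.le, ?_⟩)
    have h2 : (n : ℝ) * (s : ℝ) < (n : ℝ) * (t : ℝ) := mul_lt_mul_of_pos_left hst hn
    have h3 : ((⌈(n : ℝ) * (t : ℝ)⌉₊ - 1 : ℕ) : ℝ) + 1 = ⌈(n : ℝ) * (t : ℝ)⌉₊ := by
      exact_mod_cast Nat.sub_add_cancel hceil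
    rw [h3]
    exact h2.trans_le (Nat.le_ceil _)
  · refine ⟨0, ?_⟩
    filter_upwards [self_mem_nhdsWithin] with s hs
    have hst : (n : ℝ) * (s : ℝ) ≤ 0 :=
      (mul_le_mul_of_nonneg_left (le_of_lt hs) n.cast_nonneg).trans (not_lt.1 h)
    exact Fin.ext (Nat.floor_of_nonpos hst)

/-- The path `t ↦ S_{⌊n t⌋}`, `t ∈ [0,1]`, of a spin configuration `S` on the chain. -/
def spinPath (n : ℕ) (S : Fin (n + 1) → Circle) : CadlagPath Circle where
  toFun t := S (site n t)
  right_continuous t :=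
    tendsto_nhds_of_eventually_eq ((site_eventually_right n t).mono fun _ h => by rw [h])
  left_limit t := by
    obtain ⟨j, hj⟩ := site_eventually_left n t
    exact ⟨S j, tendsto_nhds_of_eventually_eq (hj.mono fun _ h => by rw [h])⟩

/-- Arc length on the unit circle: the image of Lebesgue measure on `(-π, π]` under `θ ↦ e^{iθ}`. -/
def arcLength : Measure Circle :=
  (volume.restrict (Ioc (-Real.pi) Real.pi)).map Circle.exp

/-- The Hamiltonian of the chain with free boundary conditions,
`H(S) = - ∑_{j=1}^{n} S_{j-1} · S_j`, where `·` is the inner product of `ℝ² = ℂ`. -/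
def hamiltonian (n : ℕ) (S : Fin (n + 1) → Circle) : ℝ :=
  -∑ j : Fin n, inner ℝ (S j.castSucc : ℂ) (S j.succ : ℂ)

/-- The Gibbs measure `Z⁻¹ exp(-β H(S)) ∏_j dS_j` at inverse temperature `β`. -/
def gibbs (n : ℕ) (β : ℝ) : Measure (Fin (n + 1) → Circle) :=
  (Measure.pi fun _ => arcLength).tilted fun S => -β * hamiltonian n S

instance : IsFiniteMeasure arcLength := by
  unfold arcLength; infer_instance

instance : NeZero arcLength := by
  refine ⟨fun h => ?_⟩
  have h1 : arcLength univ = 0 := by simp [h]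
  rw [arcLength, Measure.map_apply Circle.exp.continuous.measurable MeasurableSet.univ] at h1
  simp [Real.pi_pos.not_ge] at h1

instance (n : ℕ) (β : ℝ) : IsProbabilityMeasure (gibbs n β) := by
  have hc : Continuous fun S : Fin (n + 1) → Circle => Real.exp (-β * hamiltonian n S) := by
    unfold hamiltonian; fun_prop
  have : NeZero (Measure.pi fun _ : Fin (n + 1) => arcLength) := by
    refine ⟨fun h => ?_⟩
    have h1 : (Measure.pi fun _ : Fin (n + 1) => arcLength) univ = 0 := by simp [h]
    rw [Measure.pi_univ, Finset.prod_eq_zero_iff] at h1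
    obtain ⟨_, _, h2⟩ := h1
    exact NeZero.ne arcLength (Measure.measure_univ_eq_zero.1 h2)
  exact isProbabilityMeasure_tilted (hc.integrable_of_hasCompactSupport
    (HasCompactSupport.of_compactSpace _))

end XYChain

end

/-! Rotation invariance turns the chain into a random walk. In the variables S_0, S_1/S_0, S_2/S_1,
... the product of arc lengths is unchanged, since partial products form a surjective endomorphism
of a compact group and so preserve Haar measure. The energy becomes a sum of one-variable functions.
The Gibbs measure is therefore the law of a walk on the circle with a uniform start and independent
steps of density proportional to exp(β cos θ) (`gibbs_eq_map_walk`).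

Laplace's method gives β (1 - c_k(β)) → k²/2 for the k-th Fourier coefficient of one step. When
β_n/n → b, a block of about τn steps has k-th coefficient tending to exp(-k²τ/(2b)), which is that
of exp(iB(τ)/√b) (`tendsto_vonMisesCoeff_pow`). By independence over disjoint blocks and Lévy's
theorem on the torus, the starting spin and the grid increments converge jointly
(`tendsto_integral_blocks`).

Tightness is quantitative. Ottaviani's inequality reduces the maximal displacement over a block of
macroscopic length 1/m to its final displacement, whose fourth moment is O(1/m²). Summing over m + 1
blocks leaves O(1/m) (`eventually_measureReal_oscillates_lt`).

The limit path is almost surely continuous, so its step interpolations on the grid converge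
uniformly, hence in the Skorohod distance. For a bounded Lipschitz test function, a triangle
inequality through the two interpolations finishes the proof. -/

noncomputable section

/-! ### Exponential tilting of product and image measures. -/

/-- Tilting a product measure by a sum of one-coordinate functions tilts every factor. -/
theorem pi_tilted_sum {ι : Type*} [Fintype ι] {α : ι → Type*} [∀ i, MeasurableSpace (α i)]
    (μ : ∀ i, Measure (α i)) [∀ i, IsFiniteMeasure (μ i)] (f : ∀ i, α i → ℝ)
    [∀ i, SigmaFinite ((μ i).tilted (f i))] :
    (Measure.pi μ).tilted (fun x => ∑ i, f i (x i)) = Measure.pi fun i => (μ i).tilted (f i) := by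
  symm
  refine Measure.pi_eq fun s hs => ?_
  rw [tilted_apply_eq_ofReal_integral' _ (MeasurableSet.univ_pi hs)]
  simp_rw [fun i => tilted_apply_eq_ofReal_integral' (μ := μ i) (f i) (hs i)]
  rw [← ENNReal.ofReal_prod_of_nonneg fun i _ => integral_nonneg fun x => by positivity,
    Measure.restrict_pi_pi]
  congr 1
  simp_rw [Real.exp_sum]
  rw [integral_fintype_prod_eq_prod (fun i x => Real.exp (f i x))]
  simp_rw [← Finset.prod_div_distrib]
  rw [integral_fintype_prod_eq_prod
    (fun i x => Real.exp (f i x) / ∫ y, Real.exp (f i y) ∂(μ i))]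

/-- Tilting commutes with measurable push-forward. -/
theorem tilted_map {α γ : Type*} [MeasurableSpace α] [MeasurableSpace γ] {μ : Measure α}
    {T : α → γ} (hT : Measurable T) {f : γ → ℝ} (hf : Measurable f) :
    (μ.map T).tilted f = (μ.tilted (f ∘ T)).map T := by
  ext s hs
  rw [Measure.map_apply hT hs, tilted_apply' _ _ hs, tilted_apply' _ _ (hT hs),
    integral_map hT.aemeasurable (by fun_prop), setLIntegral_map hs (by fun_prop) hT]
  rfl

namespace XYChain

/-! ### The Gibbs measure as the law of a random walk on the circle. -/

theorem arcLength_eq_map_addCircle [Fact (0 < 2 * Real.pi)] :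
    arcLength = (volume : Measure (AddCircle (2 * Real.pi))).map AddCircle.homeomorphCircle' := by
  have h := AddCircle.measurePreserving_mk (2 * Real.pi) (-Real.pi)
  rw [← h.map_eq, Measure.map_map AddCircle.homeomorphCircle'.continuous.measurable h.measurable,
    show -Real.pi + 2 * Real.pi = Real.pi by ring]
  rfl

instance : arcLength.IsHaarMeasure := by
  have : Fact (0 < 2 * Real.pi) := ⟨Real.two_pi_pos⟩
  have : arcLength.IsMulLeftInvariant := by
    refine ⟨fun g => ?_⟩
    have hc := AddCircle.homeomorphCircle'.continuous.measurable
    rw [arcLength_eq_map_addCircle, Measure.map_map (by fun_prop) hc]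
    obtain ⟨a, rfl⟩ := AddCircle.homeomorphCircle'.surjective g
    have hg : (fun x => AddCircle.homeomorphCircle' a * x) ∘ AddCircle.homeomorphCircle'
        = AddCircle.homeomorphCircle' ∘ fun x => a + x := by
      ext1 x
      induction a using QuotientAddGroup.induction_on with | _ a =>
      induction x using QuotientAddGroup.induction_on with | _ x =>
      simp only [Function.comp_apply, ← QuotientAddGroup.mk_add]
      exact (Circle.exp_add a x).symm
    rw [hg, ← Measure.map_map hc (by fun_prop), map_add_left_eq_self]
  exact Measure.isHaarMeasure_of_isCompact_nonempty_interior arcLength univ isCompact_univ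
    (by simp) (by simpa using NeZero.ne arcLength) (measure_ne_top _ _)

/-- The law of a single spin: the normalized arc length. -/
def uniformSpin : Measure Circle := arcLength.tilted fun _ => 0

/-- The von Mises law, with density proportional to `exp (β cos θ)`. -/
def vonMises (β : ℝ) : Measure Circle := arcLength.tilted fun z => β * (z : ℂ).re

instance : IsProbabilityMeasure uniformSpin :=
  isProbabilityMeasure_tilted (by simp)

instance (β : ℝ) : IsProbabilityMeasure (vonMises β) :=
  isProbabilityMeasure_tilted (Continuous.integrable_of_hasCompactSupport (by fun_prop)
    (HasCompactSupport.of_compactSpace _))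

/-- The law of the `i`-th step of the chain: a uniform starting spin, then von Mises rotations. -/
def stepLaw (β : ℝ) (i : ℕ) : Measure Circle := if i = 0 then uniformSpin else vonMises β

instance (β : ℝ) (i : ℕ) : IsProbabilityMeasure (stepLaw β i) := by
  unfold stepLaw; split_ifs <;> infer_instance

/-- The product law of an infinite sequence of independent steps. -/
def steps (β : ℝ) : Measure (ℕ → Circle) := Measure.infinitePi (stepLaw β)

instance (β : ℝ) : IsProbabilityMeasure (steps β) := by unfold steps; infer_instance

/-- The spin at vertex `k` as the product of the first steps. -/
def walk (ξ : ℕ → Circle) (k : ℕ) : Circle := ∏ i ∈ Finset.range (k + 1), ξ i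

/-- Partial products as a group endomorphism. -/
def cumProd (n : ℕ) : (Fin n → Circle) →* (Fin n → Circle) where
  toFun x j := ∏ i ∈ Finset.Iic j, x i
  map_one' := by ext; simp
  map_mul' x y := by ext1 j; simp [Finset.prod_mul_distrib]

theorem continuous_cumProd (n : ℕ) : Continuous (cumProd n) := by
  change Continuous fun (x : Fin n → Circle) j => ∏ i ∈ Finset.Iic j, x i
  fun_prop

theorem Iic_succ_eq {n : ℕ} (j : Fin n) :
    Finset.Iic j.succ = insert j.succ (Finset.Iic j.castSucc) := by
  ext i
  simp only [Finset.mem_Iic, Finset.mem_insert, Fin.le_def, Fin.ext_iff, Fin.val_succ,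
    Fin.val_castSucc]
  omega

theorem cumProd_zero {n : ℕ} (x : Fin (n + 1) → Circle) : cumProd (n + 1) x 0 = x 0 := by
  have : Finset.Iic (0 : Fin (n + 1)) = {0} := by ext; simp
  simp [cumProd, this]

theorem cumProd_succ {n : ℕ} (x : Fin (n + 1) → Circle) (j : Fin n) :
    cumProd (n + 1) x j.succ = x j.succ * cumProd (n + 1) x j.castSucc := by
  change ∏ i ∈ Finset.Iic j.succ, x i = _
  rw [Iic_succ_eq, Finset.prod_insert (by simp [Fin.le_def])]
  rfl

/-- The recursion determines the partial products. This one criterion identifies the spins, the walk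
at grid times and the limit path at grid points. -/
theorem eq_cumProd {n : ℕ} {x y : Fin (n + 1) → Circle} (h0 : x 0 = y 0)
    (hs : ∀ j : Fin n, x j.succ * y j.castSucc = y j.succ) : cumProd (n + 1) x = y := by
  ext1 j
  induction j using Fin.induction with
  | zero => rw [cumProd_zero, h0]
  | succ j ih => rw [cumProd_succ, ih, hs]

theorem cumProd_surjective (n : ℕ) : Function.Surjective (cumProd (n + 1)) := fun y =>
  ⟨Fin.cons (y 0) fun j => y j.succ / y j.castSucc, eq_cumProd (by simp) fun j => by simp⟩

/-- A continuous surjective endomorphism of a compact group carries Haar measure to a Haar measure,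
and the total masses agree, so no Jacobian is needed. -/
theorem measurePreserving_cumProd (n : ℕ) :
    MeasurePreserving (cumProd (n + 1)) (Measure.pi fun _ => arcLength)
      (Measure.pi fun _ => arcLength) :=
  MonoidHom.measurePreserving (continuous_cumProd _) (cumProd_surjective n) rfl

/-- The interaction of two neighbours depends only on the rotation between them; this decouples the
energy. -/
theorem inner_circle_mul (x y : Circle) : inner ℝ (x : ℂ) ((y * x : Circle) : ℂ) = (y : ℂ).re := by
  have h := Circle.normSq_coe x
  rw [Complex.normSq_apply] at h
  simp only [Complex.inner, Circle.coe_mul, Complex.mul_re, Complex.mul_im, Complex.conj_re,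
    Complex.conj_im]
  linear_combination (y : ℂ).re * h

theorem hamiltonian_cumProd (n : ℕ) (x : Fin (n + 1) → Circle) :
    hamiltonian n (cumProd (n + 1) x) = -∑ j : Fin n, (x j.succ : ℂ).re := by
  simp only [hamiltonian, cumProd_succ, inner_circle_mul]

theorem map_steps_restrict (β : ℝ) (n : ℕ) :
    (steps β).map (fun ξ (i : Fin n) => ξ i) = Measure.pi fun i : Fin n => stepLaw β i := by
  rw [steps, Measure.map_infinitePi_infinitePi_of_inj Fin.val_injective,
    Measure.infinitePi_eq_pi]

theorem cumProd_restrict (n : ℕ) (ξ : ℕ → Circle) :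
    cumProd (n + 1) (fun i => ξ i) = fun j : Fin (n + 1) => walk ξ j :=
  eq_cumProd (by simp [walk]) fun j => by
    simp [walk, Finset.prod_range_succ _ ((j : ℕ) + 1), mul_comm]

/-- Under the Gibbs measure the chain is a random walk on the circle with a uniform starting
point and von Mises steps. -/
theorem gibbs_eq_map_walk (n : ℕ) (β : ℝ) :
    gibbs n β = (steps β).map fun ξ (j : Fin (n + 1)) => walk ξ j := by
  have hm : Measurable fun S : Fin (n + 1) → Circle => -β * hamiltonian n S := by
    refine Continuous.measurable ?_
    unfold hamiltonian; fun_prop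
  have hT := (continuous_cumProd (n + 1)).measurable
  have h1 : gibbs n β = (Measure.pi fun i : Fin (n + 1) => stepLaw β i).map (cumProd (n + 1)) := by
    rw [gibbs, ← (measurePreserving_cumProd n).map_eq, tilted_map hT hm]
    congr 1
    -- The energy does not involve the starting spin, so coordinate 0 is tilted by zero and stays
    -- uniform.
    let f : Fin (n + 1) → Circle → ℝ := Fin.cons (fun _ => 0) fun _ z => β * (z : ℂ).re
    have hf : ∀ i : Fin (n + 1), stepLaw β i = arcLength.tilted (f i) := by
      refine Fin.cases ?_ fun j => ?_ <;> simp [stepLaw, f, uniformSpin, vonMises]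
    have : ∀ i, SigmaFinite (arcLength.tilted (f i)) := fun i => by rw [← hf]; infer_instance
    simp_rw [hf]
    rw [← pi_tilted_sum]
    congr 1
    ext x
    simp [hamiltonian_cumProd, Fin.sum_univ_succ, f, Finset.mul_sum]
  rw [h1, ← map_steps_restrict, Measure.map_map hT (by fun_prop)]
  congr 1
  ext1 ξ
  exact cumProd_restrict n ξ

end XYChain

/-! ### Laplace's method on the circle. -/

theorem tendsto_mul_cos_sub_one (c : ℝ) :
    Tendsto (fun β : ℝ => β * (Real.cos (c / √β) - 1)) atTop (𝓝 (-(c ^ 2 / 2))) := by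
  rw [tendsto_iff_norm_sub_tendsto_zero]
  -- The constant 5/96 is that of the quartic remainder in `Real.cos_bound`.
  have h0 : Tendsto (fun β : ℝ => c ^ 4 * (5 / 96) / β) atTop (𝓝 0) :=
    tendsto_const_nhds.div_atTop tendsto_id
  refine squeeze_zero' (Eventually.of_forall fun _ => norm_nonneg _) ?_ h0
  have h1 : Tendsto (fun β : ℝ => |c / √β|) atTop (𝓝 0) := by
    simpa using (tendsto_const_nhds.div_atTop Real.tendsto_sqrt_atTop (a := c)).abs
  filter_upwards [eventually_gt_atTop 0, h1.eventually_le_const one_pos] with β hβ hc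
  have h2 := Real.cos_bound hc
  have hsq : √β ^ 2 = β := Real.sq_sqrt hβ.le
  have hs : 0 < √β := Real.sqrt_pos.2 hβ
  have h3 : β * (Real.cos (c / √β) - 1) - -(c ^ 2 / 2)
      = β * (Real.cos (c / √β) - (1 - (c / √β) ^ 2 / 2)) := by
    rw [div_pow, hsq]; field_simp; ring
  have h4 : |c / √β| ^ 4 = c ^ 4 / β ^ 2 := by
    rw [← abs_pow, div_pow, show √β ^ 4 = (√β ^ 2) ^ 2 by ring, hsq]
    exact abs_of_nonneg (by positivity)
  rw [h4] at h2
  rw [h3, Real.norm_eq_abs, abs_mul, abs_of_pos hβ]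
  calc _ ≤ β * (c ^ 4 / β ^ 2 * (5 / 96)) := by gcongr
    _ = _ := by field_simp

/-- The quadratic upper bound for cos on all of [-π, π] supplies a Gaussian majorant independent of
β, for dominated convergence. -/
theorem mul_cos_sub_one_le {β x : ℝ} (hβ : 0 < β) (hx : |x / √β| ≤ Real.pi) :
    β * (Real.cos (x / √β) - 1) ≤ -(2 / Real.pi ^ 2) * x ^ 2 := by
  have h := Real.cos_le_one_sub_mul_cos_sq hx
  rw [div_pow, Real.sq_sqrt hβ.le] at h
  calc β * (Real.cos (x / √β) - 1) ≤ β * (-(2 / Real.pi ^ 2 * (x ^ 2 / β))) := by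
        gcongr; linarith
    _ = _ := by field_simp

theorem mul_one_sub_cos_le {β : ℝ} (hβ : 0 < β) (x : ℝ) :
    β * (1 - Real.cos (x / √β)) ≤ x ^ 2 / 2 := by
  have h := Real.one_sub_sq_div_two_le_cos (x := x / √β)
  rw [div_pow, Real.sq_sqrt hβ.le] at h
  calc β * (1 - Real.cos (x / √β)) ≤ β * (x ^ 2 / β / 2) := by gcongr; linarith
    _ = _ := by field_simp

theorem sqrt_mul_setIntegral_eq {β : ℝ} (hβ : 0 < β) (g : ℝ → ℝ) :
    √β * ∫ θ in Ioc (-Real.pi) Real.pi, g θ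
      = ∫ x, (Ioc (-Real.pi) Real.pi).indicator g (x / √β) := by
  rw [Measure.integral_comp_div, integral_indicator measurableSet_Ioc,
    abs_of_pos (Real.sqrt_pos.2 hβ), smul_eq_mul]

theorem eventually_div_sqrt_mem (x : ℝ) :
    ∀ᶠ β : ℝ in atTop, x / √β ∈ Ioc (-Real.pi) Real.pi :=
  (tendsto_const_nhds.div_atTop Real.tendsto_sqrt_atTop).eventually
    (Ioc_mem_nhds (by simp [Real.pi_pos]) Real.pi_pos)

/-- Laplace's method on the circle, for amplitudes `h β θ` which on the scale `θ = x / √β`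
converge to `H x` and are dominated by a quadratic. -/
theorem tendsto_laplace {h : ℝ → ℝ → ℝ} {H : ℝ → ℝ} {A C : ℝ}
    (hm : ∀ β, Measurable (h β)) (hb : ∀ β > 0, ∀ x, |h β (x / √β)| ≤ A + C * x ^ 2)
    (hlim : ∀ x, Tendsto (fun β => h β (x / √β)) atTop (𝓝 (H x))) :
    Tendsto (fun β : ℝ => √β * ∫ θ in Ioc (-Real.pi) Real.pi,
      h β θ * Real.exp (β * (Real.cos θ - 1))) atTop
      (𝓝 (∫ x, H x * Real.exp (-(x ^ 2 / 2)))) := by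
  have hpi : 0 < 2 / Real.pi ^ 2 := by positivity
  have hint : Integrable fun x : ℝ => (A + C * x ^ 2) * Real.exp (-(2 / Real.pi ^ 2) * x ^ 2) := by
    have h1 := (integrable_exp_neg_mul_sq hpi).const_mul A
    have h2 := (integrable_rpow_mul_exp_neg_mul_sq hpi (s := 2) (by norm_num)).const_mul C
    refine (h1.add h2).congr (Eventually.of_forall fun x => ?_)
    simp; ring
  have key : Tendsto (fun β : ℝ => ∫ x, (Ioc (-Real.pi) Real.pi).indicator
      (fun θ => h β θ * Real.exp (β * (Real.cos θ - 1))) (x / √β)) atTop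
      (𝓝 (∫ x, H x * Real.exp (-(x ^ 2 / 2)))) := by
    refine tendsto_integral_filter_of_dominated_convergence _ (Eventually.of_forall fun β => ?_)
      ?_ hint (Eventually.of_forall fun x => ?_)
    · have : Measurable ((Ioc (-Real.pi) Real.pi).indicator
          (fun θ => h β θ * Real.exp (β * (Real.cos θ - 1)))) :=
        ((hm β).mul (by fun_prop)).indicator measurableSet_Ioc
      exact (this.comp (measurable_id.div_const _)).aestronglyMeasurable
    · filter_upwards [eventually_gt_atTop 0] with β hβ
      refine Eventually.of_forall fun x => ?_
      have hA := (abs_nonneg _).trans (hb β hβ x)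
      by_cases hx : x / √β ∈ Ioc (-Real.pi) Real.pi
      · rw [indicator_of_mem hx, norm_mul, Real.norm_eq_abs, Real.norm_eq_abs, Real.abs_exp]
        exact mul_le_mul (hb β hβ x)
          (Real.exp_le_exp.2 (mul_cos_sub_one_le hβ (abs_le.2 ⟨hx.1.le, hx.2⟩)))
          (Real.exp_nonneg _) hA
      · rw [indicator_of_notMem hx, norm_zero]
        positivity
    · have h1 := (hlim x).mul ((Real.continuous_exp.tendsto _).comp (tendsto_mul_cos_sub_one x))
      refine h1.congr' ?_
      filter_upwards [eventually_div_sqrt_mem x] with β hx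
      rw [indicator_of_mem hx]
      rfl
  refine key.congr' ?_
  filter_upwards [eventually_gt_atTop 0] with β hβ
  rw [sqrt_mul_setIntegral_eq hβ]

theorem integral_exp_neg_sq_div_two : ∫ x : ℝ, Real.exp (-(x ^ 2 / 2)) = √(2 * Real.pi) := by
  have h := integral_gaussian (1 / 2)
  calc _ = ∫ x : ℝ, Real.exp (-(1 / 2) * x ^ 2) := by congr 1; ext x; congr 1; ring
    _ = _ := by rw [h]; congr 1; ring

theorem integral_sq_mul_exp_neg_sq_div_two :
    ∫ x : ℝ, x ^ 2 * Real.exp (-(x ^ 2 / 2)) = √(2 * Real.pi) := by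
  have h := variance_id_gaussianReal (μ := 0) (v := 1)
  rw [variance_eq_integral aemeasurable_id,
    integral_gaussianReal_eq_integral_smul one_ne_zero] at h
  simp only [id_eq, integral_id_gaussianReal, sub_zero, gaussianPDFReal, NNReal.coe_one, mul_one,
    smul_eq_mul] at h
  have h2 : ∫ x : ℝ, x ^ 2 * Real.exp (-(x ^ 2 / 2)) = √(2 * Real.pi) *
      ∫ x : ℝ, (√(2 * Real.pi))⁻¹ * Real.exp (-x ^ 2 / 2) * x ^ 2 := by
    rw [← integral_const_mul]
    congr 1; ext x
    have : 0 < √(2 * Real.pi) := by positivity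
    field_simp
  rw [h2, h, mul_one]

namespace XYChain

/-! ### Asymptotics of the Fourier coefficients of one step. -/

/-- The Fourier coefficients of the von Mises law. -/
def vonMisesCoeff (β : ℝ) (k : ℤ) : ℂ := ∫ z : Circle, ((z ^ k : Circle) : ℂ) ∂(vonMises β)

theorem integral_arcLength {E : Type*} [NormedAddCommGroup E] [NormedSpace ℝ E] {f : Circle → E}
    (hf : Continuous f) :
    ∫ z, f z ∂arcLength = ∫ θ in Ioc (-Real.pi) Real.pi, f (Circle.exp θ) := by
  rw [arcLength, integral_map Circle.exp.continuous.measurable.aemeasurable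
    hf.aestronglyMeasurable]

/-- The weight is even in θ, so averaging the integrand over θ and -θ removes the sine part. -/
theorem setIntegral_exp_mul_eq_cos (β : ℝ) (k : ℤ) :
    ∫ θ in Ioc (-Real.pi) Real.pi, Real.exp (β * Real.cos θ) • Complex.exp (k * θ * Complex.I)
      = ((∫ θ in Ioc (-Real.pi) Real.pi, Real.cos (k * θ) * Real.exp (β * Real.cos θ) : ℝ) :
        ℂ) := by
  have hle : -Real.pi ≤ Real.pi := by linarith [Real.pi_pos]
  rw [← integral_complex_ofReal, ← intervalIntegral.integral_of_le hle,
    ← intervalIntegral.integral_of_le hle]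
  set F : ℝ → ℂ := fun θ => Real.exp (β * Real.cos θ) • Complex.exp (k * θ * Complex.I) with hF
  have hFc : Continuous F := by fun_prop
  have h1 : ∫ θ in -Real.pi..Real.pi, F (-θ) = ∫ θ in -Real.pi..Real.pi, F θ := by
    rw [intervalIntegral.integral_comp_neg, neg_neg]
  have hFn : Continuous fun θ => F (-θ) := hFc.comp continuous_neg
  have h2 : ∫ θ in -Real.pi..Real.pi, F θ
      = ∫ θ in -Real.pi..Real.pi, (F θ + F (-θ)) / 2 := by
    rw [intervalIntegral.integral_div, intervalIntegral.integral_add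
      (hFc.intervalIntegrable _ _) (hFn.intervalIntegrable _ _), h1]
    ring
  rw [h2]
  congr 1
  ext θ
  simp only [hF, Real.cos_neg, Complex.real_smul]
  push_cast
  have hc : Complex.cos (k * θ)
      = (Complex.exp (k * θ * Complex.I) + Complex.exp (-(k * θ) * Complex.I)) / 2 := rfl
  rw [hc]
  ring_nf

/-- Replacing cos θ by cos θ - 1 multiplies numerator and denominator by the same exp(-β), which
puts the ratio in the form treated by `tendsto_laplace`. -/
theorem vonMisesCoeff_eq (β : ℝ) (k : ℤ) : vonMisesCoeff β k
    = (((∫ θ in Ioc (-Real.pi) Real.pi, Real.cos (k * θ) * Real.exp (β * (Real.cos θ - 1)))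
      / ∫ θ in Ioc (-Real.pi) Real.pi, Real.exp (β * (Real.cos θ - 1)) : ℝ) : ℂ) := by
  have hexp : ∀ θ : ℝ, (((Circle.exp θ) ^ k : Circle) : ℂ) = Complex.exp (k * θ * Complex.I) := by
    intro θ
    rw [Circle.coe_zpow, Circle.coe_exp, ← Complex.exp_int_mul, mul_assoc]
  have hre : ∀ θ : ℝ, ((Circle.exp θ : Circle) : ℂ).re = Real.cos θ := by
    intro θ; rw [Circle.coe_exp, Complex.exp_ofReal_mul_I_re]
  have hz : Continuous fun z : Circle => ((z ^ k : Circle) : ℂ) :=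
    continuous_induced_dom.comp (continuous_zpow k)
  have hw : Continuous fun z : Circle => Real.exp (β * (z : ℂ).re)
      / ∫ z : Circle, Real.exp (β * (z : ℂ).re) ∂arcLength := by fun_prop
  have hz' : Continuous fun z : Circle => (Real.exp (β * (z : ℂ).re)
      / ∫ z : Circle, Real.exp (β * (z : ℂ).re) ∂arcLength) • ((z ^ k : Circle) : ℂ) :=
    hw.smul hz
  rw [vonMisesCoeff, vonMises, integral_tilted,
    integral_arcLength hz',
    integral_arcLength (by fun_prop)]
  simp_rw [hexp, hre]
  simp_rw [div_eq_inv_mul, mul_smul]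
  rw [integral_smul, setIntegral_exp_mul_eq_cos, ← Complex.coe_smul, smul_eq_mul]
  norm_cast
  have e : ∀ θ, Real.exp (β * (Real.cos θ - 1)) = Real.exp (-β) * Real.exp (β * Real.cos θ) := by
    intro θ; rw [← Real.exp_add]; ring_nf
  simp_rw [e, mul_left_comm _ (Real.exp (-β))]
  rw [integral_const_mul, integral_const_mul, mul_inv]
  have := Real.exp_ne_zero (-β)
  field_simp

/-- On the scale θ = x/√β the amplitude β (1 - cos kθ) tends to k²x²/2. The limit is thus k²/2 times
the second moment of a standard Gaussian. -/
theorem tendsto_mul_one_sub_vonMisesCoeff (k : ℤ) :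
    Tendsto (fun β : ℝ => (β : ℂ) * (1 - vonMisesCoeff β k)) atTop (𝓝 ((k : ℂ) ^ 2 / 2)) := by
  have hD := tendsto_laplace (h := fun _ _ => 1) (H := fun _ => 1) (A := 1) (C := 0)
    (by fun_prop) (by simp) (fun x => tendsto_const_nhds)
  have hN := tendsto_laplace (h := fun β θ => β * (1 - Real.cos (k * θ)))
    (H := fun x => k ^ 2 / 2 * x ^ 2) (A := 0) (C := k ^ 2 / 2) (by fun_prop)
    (fun β hβ x => by
      have h1 := mul_one_sub_cos_le hβ (k * x)
      have h2 : 0 ≤ β * (1 - Real.cos (k * x / √β)) :=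
        mul_nonneg hβ.le (by linarith [Real.cos_le_one (k * x / √β)])
      rw [← mul_div_assoc, abs_of_nonneg h2]
      linarith)
    (fun x => by
      have h1 := (tendsto_mul_cos_sub_one (k * x)).neg
      refine (h1.congr fun β => ?_).trans (by rw [neg_neg]; ring_nf; exact le_rfl)
      rw [← mul_div_assoc]; ring)
  simp only [one_mul, mul_assoc] at hD hN
  rw [integral_exp_neg_sq_div_two] at hD
  rw [integral_const_mul, integral_sq_mul_exp_neg_sq_div_two] at hN
  have hne : √(2 * Real.pi) ≠ 0 := by positivity
  have h := hN.div hD hne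
  rw [mul_div_cancel_right₀ _ hne] at h
  have h' := (Complex.continuous_ofReal.tendsto _).comp h
  have hval : (((k : ℝ) ^ 2 / 2 : ℝ) : ℂ) = (k : ℂ) ^ 2 / 2 := by push_cast; ring
  rw [hval] at h'
  refine h'.congr' ?_
  filter_upwards [eventually_gt_atTop 0, hD.eventually_ne hne] with β hβ hDβ
  have hs : √β ≠ 0 := (Real.sqrt_pos.2 hβ).ne'
  have hne' : ∫ θ in Ioc (-Real.pi) Real.pi, Real.exp (β * (Real.cos θ - 1)) ≠ 0 :=
    right_ne_zero_of_mul hDβ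
  rw [vonMisesCoeff_eq]
  simp only [Function.comp_apply, Pi.div_apply]
  norm_cast
  rw [integral_const_mul, mul_div_mul_left _ _ hs, mul_div_assoc]
  simp_rw [sub_mul, one_mul]
  rw [integral_sub (Continuous.integrableOn_Ioc (by fun_prop))
    (Continuous.integrableOn_Ioc (by fun_prop)), sub_div, div_self hne']

/-- Powers of the Fourier coefficients converge to the Fourier coefficients of the Gaussian. -/
theorem tendsto_vonMisesCoeff_pow {β : ℕ → ℝ} {b : ℝ} (hb : 0 < b)
    (hβ : Tendsto (fun n : ℕ => β n / (n : ℝ)) atTop (𝓝 b)) (k : ℤ) {ℓ : ℕ → ℕ} {τ : ℝ}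
    (hℓ : Tendsto (fun n : ℕ => (ℓ n : ℝ) / n) atTop (𝓝 τ)) :
    Tendsto (fun n => vonMisesCoeff (β n) k ^ ℓ n) atTop
      (𝓝 (Complex.exp (-(k ^ 2 * τ / (2 * b))))) := by
  have hβtop : Tendsto β atTop atTop := by
    refine (hβ.pos_mul_atTop hb tendsto_natCast_atTop_atTop).congr' ?_
    filter_upwards [eventually_ne_atTop 0] with n hn
    have : (n : ℝ) ≠ 0 := by exact_mod_cast hn
    field_simp
  have hbC : (b : ℂ) ≠ 0 := by exact_mod_cast hb.ne'
  have h1 := (tendsto_mul_one_sub_vonMisesCoeff k).comp hβtop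
  have h2 : Tendsto (fun n : ℕ => ((β n / n : ℝ) : ℂ)) atTop (𝓝 b) :=
    (Complex.continuous_ofReal.tendsto _).comp hβ
  have h3 : Tendsto (fun n : ℕ => (n : ℂ) * (vonMisesCoeff (β n) k - 1)) atTop
      (𝓝 (-((k : ℂ) ^ 2 / 2 / b))) := by
    refine (h1.div h2 hbC).neg.congr' ?_
    filter_upwards [eventually_ne_atTop 0, hβtop.eventually_gt_atTop 0] with n hn hβn
    have hn' : (n : ℂ) ≠ 0 := by exact_mod_cast hn
    have hβ' : (β n : ℂ) ≠ 0 := by exact_mod_cast hβn.ne'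
    simp only [Function.comp_apply, Pi.div_apply]
    push_cast
    field_simp
    ring
  have h4 := Complex.tendsto_nat_mul_log_one_add_of_tendsto h3
  have h5 : Tendsto (fun n : ℕ => ((ℓ n / n : ℝ) : ℂ)) atTop (𝓝 τ) :=
    (Complex.continuous_ofReal.tendsto _).comp hℓ
  have h6 := (Complex.continuous_exp.tendsto _).comp (h5.mul h4)
  rw [show (τ : ℂ) * -((k : ℂ) ^ 2 / 2 / b) = -(k ^ 2 * τ / (2 * b)) by field_simp] at h6
  -- Nonvanishing is needed to write the ℓ-th power as exp(ℓ log z).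
  have hne : ∀ᶠ n : ℕ in atTop, vonMisesCoeff (β n) k ≠ 0 := by
    have h7 : Tendsto (fun n : ℕ => vonMisesCoeff (β n) k) atTop (𝓝 1) := by
      have h8 := (tendsto_inv_atTop_nhds_zero_nat (𝕜 := ℂ)).mul h3
      rw [zero_mul] at h8
      refine ((h8.add_const 1).congr' ?_).trans (by simp)
      filter_upwards [eventually_ne_atTop 0] with n hn
      have hn' : (n : ℂ) ≠ 0 := by exact_mod_cast hn
      field_simp
      ring
    exact h7.eventually_ne one_ne_zero
  refine h6.congr' ?_
  filter_upwards [eventually_ne_atTop 0, hne] with n hn hz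
  have hn' : (n : ℂ) ≠ 0 := by exact_mod_cast hn
  simp only [Function.comp_apply, add_sub_cancel]
  push_cast
  rw [← mul_assoc, div_mul_cancel₀ _ hn', Complex.exp_nat_mul, Complex.exp_log hz]

/-! ### Lévy's continuity theorem on the torus, through Stone–Weierstrass. -/

section Torus

variable {ι : Type*} [Fintype ι]

theorem continuous_circle_coe : Continuous fun z : Circle => (z : ℂ) := by fun_prop

theorem continuous_circle_zpow (k : ℤ) : Continuous fun z : Circle => ((z ^ k : Circle) : ℂ) :=
  continuous_circle_coe.comp (continuous_zpow k)

theorem circle_coe_prod {κ : Type*} (s : Finset κ) (f : κ → Circle) :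
    ((∏ i ∈ s, f i : Circle) : ℂ) = ∏ i ∈ s, (f i : ℂ) := by
  classical
  induction s using Finset.induction_on with
  | empty => simp
  | insert a s ha ih => rw [Finset.prod_insert ha, Finset.prod_insert ha, Circle.coe_mul, ih]

/-- The characters of the torus. -/
def torusChar (k : ι → ℤ) : C(ι → Circle, ℂ) where
  toFun x := ((∏ i, x i ^ k i : Circle) : ℂ)
  continuous_toFun := continuous_circle_coe.comp
    (continuous_finsetProd _ fun i _ => (continuous_zpow (k i)).comp (continuous_apply i))

theorem torusChar_apply (k : ι → ℤ) (x : ι → Circle) :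
    torusChar k x = ((∏ i, x i ^ k i : Circle) : ℂ) := rfl

theorem torusChar_zero : torusChar (0 : ι → ℤ) = 1 := by
  ext x; simp [torusChar_apply]

theorem torusChar_add (k l : ι → ℤ) : torusChar (k + l) = torusChar k * torusChar l := by
  ext x
  simp only [torusChar_apply, ContinuousMap.mul_apply, ← Circle.coe_mul, Pi.add_apply, zpow_add,
    Finset.prod_mul_distrib]

theorem torusChar_neg (k : ι → ℤ) : torusChar (-k) = star (torusChar k) := by
  ext x
  simp only [torusChar_apply, ContinuousMap.star_apply, Pi.neg_apply, zpow_neg,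
    Finset.prod_inv_distrib, Circle.coe_inv_eq_conj]
  rfl

/-- The star subalgebra of trigonometric polynomials on the torus. -/
def trigPolynomials (ι : Type*) [Fintype ι] : StarSubalgebra ℂ C(ι → Circle, ℂ) where
  toSubalgebra := Algebra.adjoin ℂ (range torusChar)
  star_mem' := by
    change Algebra.adjoin ℂ (range torusChar) ≤ star (Algebra.adjoin ℂ (range torusChar))
    refine Algebra.adjoin_le ?_
    rintro _ ⟨k, rfl⟩
    exact Algebra.subset_adjoin ⟨-k, torusChar_neg k⟩

/-- Characters are closed under multiplication, so the algebra they generate is just their linear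
span; convergence then only has to be checked on characters. -/
theorem trigPolynomials_coe : (trigPolynomials ι).toSubalgebra.toSubmodule
    = Submodule.span ℂ (range torusChar) := by
  apply Algebra.adjoin_eq_span_of_subset
  refine .trans (fun x => Submonoid.closure_induction (fun _ => id) ⟨0, torusChar_zero⟩ ?_)
    Submodule.subset_span
  rintro _ _ _ _ ⟨m, rfl⟩ ⟨n, rfl⟩
  exact ⟨m + n, torusChar_add m n⟩

theorem trigPolynomials_separatesPoints : (trigPolynomials ι).SeparatesPoints := by
  classical
  intro x y hxy
  obtain ⟨i, hi⟩ := Function.ne_iff.1 hxy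
  refine ⟨_, ⟨torusChar (Pi.single i 1), Algebra.subset_adjoin ⟨_, rfl⟩, rfl⟩, ?_⟩
  have h : ∀ z : ι → Circle, torusChar (Pi.single i 1) z = (z i : ℂ) := fun z => by
    rw [torusChar_apply, Finset.prod_eq_single i (fun j _ hj => by simp [hj]) (by simp)]
    simp
  simp only [h]
  exact fun h' => hi (Circle.ext h')

theorem exists_trigPolynomial_close (g : C(ι → Circle, ℂ)) {ε : ℝ} (hε : 0 < ε) :
    ∃ h ∈ Submodule.span ℂ (range (torusChar (ι := ι))), ‖g - h‖ < ε := by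
  have hd := ContinuousMap.starSubalgebra_topologicalClosure_eq_top_of_separatesPoints
    _ (trigPolynomials_separatesPoints (ι := ι))
  have hg : g ∈ (trigPolynomials ι).topologicalClosure := hd ▸ trivial
  obtain ⟨h, hh, hgh⟩ := Metric.mem_closure_iff.1 hg ε hε
  refine ⟨h, ?_, by rwa [← dist_eq_norm]⟩
  rw [← trigPolynomials_coe]
  exact hh

theorem integrable_torus {E : Type*} [NormedAddCommGroup E] [SecondCountableTopology E]
    (μ : Measure (ι → Circle)) [IsFiniteMeasure μ] (g : C(ι → Circle, E)) : Integrable g μ :=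
  g.continuous.integrable_of_hasCompactSupport (HasCompactSupport.of_compactSpace _)

/-- Lévy's continuity theorem on the torus. -/
theorem tendsto_integral_of_tendsto_torusChar {γ : Type*} {l : Filter γ}
    {μ : γ → Measure (ι → Circle)} [∀ n, IsProbabilityMeasure (μ n)]
    {ν : Measure (ι → Circle)} [IsProbabilityMeasure ν]
    (h : ∀ k : ι → ℤ, Tendsto (fun n => ∫ x, torusChar k x ∂(μ n)) l
      (𝓝 (∫ x, torusChar k x ∂ν))) (g : C(ι → Circle, ℂ)) :
    Tendsto (fun n => ∫ x, g x ∂(μ n)) l (𝓝 (∫ x, g x ∂ν)) := by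
  have hspan : ∀ p ∈ Submodule.span ℂ (range (torusChar (ι := ι))),
      Tendsto (fun n => ∫ x, p x ∂(μ n)) l (𝓝 (∫ x, p x ∂ν)) := by
    intro p hp
    induction hp using Submodule.span_induction with
    | mem p hp => obtain ⟨k, rfl⟩ := hp; exact h k
    | zero => simp [tendsto_const_nhds]
    | add p q _ _ hp hq =>
      simp only [ContinuousMap.add_apply]
      simp_rw [fun n => integral_add (integrable_torus (μ n) p) (integrable_torus (μ n) q),
        integral_add (integrable_torus ν p) (integrable_torus ν q)]
      exact hp.add hq
    | smul c p _ hp =>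
      simp only [ContinuousMap.smul_apply, integral_smul]
      exact hp.const_smul c
  have hclose : ∀ (m : Measure (ι → Circle)) [IsProbabilityMeasure m] (p : C(ι → Circle, ℂ)),
      dist (∫ x, g x ∂m) (∫ x, p x ∂m) ≤ ‖g - p‖ := by
    intro m _ p
    rw [dist_eq_norm, ← integral_sub (integrable_torus m g) (integrable_torus m p)]
    refine (norm_integral_le_of_norm_le_const (Eventually.of_forall fun x =>
      (g - p).norm_coe_le_norm x)).trans ?_
    simp
  rw [Metric.tendsto_nhds]
  intro ε hε
  obtain ⟨p, hp, hgp⟩ := exists_trigPolynomial_close g (ε := ε / 3) (by positivity)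
  filter_upwards [Metric.tendsto_nhds.1 (hspan p hp) (ε / 3) (by positivity)] with n hn
  have h1 := hclose (μ n) p
  have h2 := hclose ν p
  rw [dist_comm] at h2
  linarith [dist_triangle4 (∫ x, g x ∂(μ n)) (∫ x, p x ∂(μ n)) (∫ x, p x ∂ν) (∫ x, g x ∂ν)]

theorem tendsto_integral_real_of_tendsto_torusChar {γ : Type*} {l : Filter γ}
    {μ : γ → Measure (ι → Circle)} [∀ n, IsProbabilityMeasure (μ n)]
    {ν : Measure (ι → Circle)} [IsProbabilityMeasure ν]
    (h : ∀ k : ι → ℤ, Tendsto (fun n => ∫ x, torusChar k x ∂(μ n)) l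
      (𝓝 (∫ x, torusChar k x ∂ν))) {g : (ι → Circle) → ℝ} (hg : Continuous g) :
    Tendsto (fun n => ∫ x, g x ∂(μ n)) l (𝓝 (∫ x, g x ∂ν)) := by
  have h1 := tendsto_integral_of_tendsto_torusChar h
    ⟨fun x => (g x : ℂ), Complex.continuous_ofReal.comp hg⟩
  have h2 := (Complex.continuous_re.tendsto _).comp h1
  simpa [Function.comp_def, integral_complex_ofReal] using h2

end Torus

/-! ### Independence of the steps over disjoint blocks. -/

theorem iIndepFun_steps (β : ℝ) : iIndepFun (fun (r : ℕ) (ξ : ℕ → Circle) => ξ r) (steps β) :=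
  iIndepFun_infinitePi (X := fun _ z => z) fun _ => measurable_id

theorem integral_steps_eval (β : ℝ) (r : ℕ) (k : ℤ) :
    ∫ ξ, ((ξ r ^ k : Circle) : ℂ) ∂(steps β) = ∫ z, ((z ^ k : Circle) : ℂ) ∂(stepLaw β r) := by
  rw [← Measure.infinitePi_map_eval (stepLaw β) r, integral_map (measurable_pi_apply r).aemeasurable
    (continuous_circle_zpow k).aestronglyMeasurable]
  rfl

/-- Joint Fourier coefficients of products of the steps over disjoint blocks. -/
theorem integral_prod_blocks {ι : Type*} [Fintype ι] (β : ℝ) {B : ι → Finset ℕ}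
    (hB : Pairwise (Function.onFun Disjoint B)) (k : ι → ℤ) :
    ∫ ξ, torusChar k (fun i => ∏ r ∈ B i, ξ r) ∂(steps β)
      = ∏ i, ∏ r ∈ B i, ∫ z, ((z ^ k i : Circle) : ℂ) ∂(stepLaw β r) := by
  -- The factors are indexed by pairs (block, step). Disjointness makes the map from pairs to steps
  -- injective, so the pairs inherit independence.
  let X : (Σ i, B i) → (ℕ → Circle) → ℂ := fun p ξ => ((ξ p.2 ^ k p.1 : Circle) : ℂ)
  have hinj : Function.Injective fun p : Σ i, B i => (p.2 : ℕ) := by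
    rintro ⟨i, r, hr⟩ ⟨j, s, hs⟩ (rfl : r = s)
    have : i = j := by
      by_contra hij
      exact Finset.disjoint_left.1 (hB hij) hr hs
    subst this
    rfl
  have hX : iIndepFun X (steps β) :=
    ((iIndepFun_steps β).precomp hinj).comp (fun p z => ((z ^ k p.1 : Circle) : ℂ))
      fun p => (continuous_circle_zpow _).measurable
  have hXm : ∀ p, AEStronglyMeasurable (X p) (steps β) := fun p =>
    ((continuous_circle_zpow _).measurable.comp
      (measurable_pi_apply (p.2 : ℕ))).aestronglyMeasurable
  have h1 := hX.integral_fun_prod_eq_prod_integral hXm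
  have h2 : ∀ ξ : ℕ → Circle, torusChar k (fun i => ∏ r ∈ B i, ξ r) = ∏ p, X p ξ := by
    intro ξ
    rw [torusChar_apply, Fintype.prod_sigma]
    simp only [X, ← Finset.prod_zpow]
    have h3 : ∀ i, ∏ r : B i, ((ξ r ^ k i : Circle) : ℂ) = ((∏ r ∈ B i, ξ r ^ k i : Circle) : ℂ) :=
      fun i => by
        rw [Finset.prod_coe_sort (B i) fun r => ((ξ r ^ k i : Circle) : ℂ)]
        exact (circle_coe_prod _ _).symm
    simp_rw [h3]
    exact circle_coe_prod _ _
  simp_rw [h2]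
  rw [h1, Fintype.prod_sigma]
  refine Finset.prod_congr rfl fun i _ => ?_
  rw [← Finset.prod_coe_sort (B i)]
  exact Finset.prod_congr rfl fun r _ => integral_steps_eval β r (k i)

theorem integral_prod_block_zpow (β : ℝ) {B : Finset ℕ} (hB : 0 ∉ B) (k : ℤ) :
    ∫ ξ, (((∏ r ∈ B, ξ r) ^ k : Circle) : ℂ) ∂(steps β) = vonMisesCoeff β k ^ B.card := by
  have h := integral_prod_blocks β (ι := Unit) (B := fun _ => B) (Subsingleton.pairwise)
    (fun _ => k)
  simp only [torusChar_apply, Fintype.prod_unique] at h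
  rw [h, ← Finset.prod_const]
  refine Finset.prod_congr rfl fun r hr => ?_
  rw [stepLaw, if_neg (ne_of_mem_of_not_mem hr hB), vonMisesCoeff]

/-- Events depending on disjoint sets of steps are independent. -/
theorem steps_inter_eq_mul (β : ℝ) {S T : Finset ℕ} (hST : Disjoint S T) {A C : Set (ℕ → Circle)}
    (hA : MeasurableSet A) (hC : MeasurableSet C)
    (hAS : ∀ ξ η : ℕ → Circle, (∀ r ∈ S, ξ r = η r) → (ξ ∈ A ↔ η ∈ A))
    (hCT : ∀ ξ η : ℕ → Circle, (∀ r ∈ T, ξ r = η r) → (ξ ∈ C ↔ η ∈ C)) :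
    steps β (A ∩ C) = steps β A * steps β C := by
  have hind := (iIndepFun_steps β).indepFun_finset S T hST fun r => measurable_pi_apply r
  -- Padding with 1 outside U realises an event depending only on U as a preimage under restriction
  -- to U.
  let ext (U : Finset ℕ) (y : U → Circle) (r : ℕ) : Circle := if h : r ∈ U then y ⟨r, h⟩ else 1
  have hext : ∀ U, Measurable (ext U) := fun U => measurable_pi_iff.2 fun r => by
    by_cases h : r ∈ U
    · simpa [ext, h] using measurable_pi_apply (⟨r, h⟩ : U)
    · simp [ext, h]
  have hpre : ∀ (U : Finset ℕ) (D : Set (ℕ → Circle)),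
      (∀ ξ η : ℕ → Circle, (∀ r ∈ U, ξ r = η r) → (ξ ∈ D ↔ η ∈ D)) →
      (fun (ξ : ℕ → Circle) (i : U) => ξ i) ⁻¹' (ext U ⁻¹' D) = D := fun U D hD => by
    ext1 ξ
    exact hD _ _ fun r hr => by simp [ext, hr]
  have h := hind.measure_inter_preimage_eq_mul _ _ (hext S hA) (hext T hC)
  rwa [hpre S A hAS, hpre T C hCT] at h

theorem measurable_prod_block (B : Finset ℕ) :
    Measurable fun ξ : ℕ → Circle => ∏ r ∈ B, ξ r :=
  Finset.measurable_fun_prod _ fun r _ => measurable_pi_apply r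

/-! ### Maximal inequality and moment bounds for block displacements. -/

theorem walk_add (ξ : ℕ → Circle) (s ℓ : ℕ) :
    walk ξ (s + ℓ) = (∏ r ∈ Finset.Ioc s (s + ℓ), ξ r) * walk ξ s := by
  have h := Finset.prod_range_mul_prod_Ico ξ (show s + 1 ≤ s + ℓ + 1 by omega)
  have h2 : Finset.Ico (s + 1) (s + ℓ + 1) = Finset.Ioc s (s + ℓ) := by
    ext r; simp only [Finset.mem_Ico, Finset.mem_Ioc]; omega
  rw [h2] at h
  rw [walk, walk, ← h, mul_comm]

theorem dist_circle (x y : Circle) : dist x y = ‖(x : ℂ) - (y : ℂ)‖ :=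
  dist_eq_norm (x : ℂ) (y : ℂ)

theorem dist_circle_mul_right (x y z : Circle) : dist (x * z) (y * z) = dist x y := by
  rw [dist_circle, dist_circle, Circle.coe_mul, Circle.coe_mul, ← sub_mul, norm_mul,
    Circle.norm_coe, mul_one]

theorem dist_walk_add (ξ : ℕ → Circle) (s ℓ : ℕ) :
    dist (walk ξ (s + ℓ)) (walk ξ s) = dist (∏ r ∈ Finset.Ioc s (s + ℓ), ξ r) 1 := by
  rw [walk_add]
  simpa using dist_circle_mul_right (∏ r ∈ Finset.Ioc s (s + ℓ), ξ r) 1 (walk ξ s)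

/-- Ottaviani's maximal inequality for the walk on the circle. -/
theorem ottaviani (β : ℝ) (s L : ℕ) (ε : ℝ)
    (h : ∀ ℓ ≤ L, 1 / 2 ≤ steps β {ξ | dist (∏ r ∈ Finset.Ioc (s + ℓ) (s + L), ξ r) 1 ≤ ε}) :
    steps β {ξ | ∃ ℓ ≤ L, 2 * ε < dist (walk ξ (s + ℓ)) (walk ξ s)}
      ≤ 2 * steps β {ξ | ε < dist (∏ r ∈ Finset.Ioc s (s + L), ξ r) 1} := by
  let D (ℓ : ℕ) (ξ : ℕ → Circle) : ℝ := dist (∏ r ∈ Finset.Ioc s (s + ℓ), ξ r) 1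
  have hD : ∀ ℓ, Measurable (D ℓ) := fun ℓ => (measurable_prod_block _).dist measurable_const
  have hDdep : ∀ ℓ (ξ η : ℕ → Circle), (∀ r ∈ Finset.Ioc s (s + ℓ), ξ r = η r) → D ℓ ξ = D ℓ η :=
    fun ℓ ξ η h => by simp only [D]; rw [Finset.prod_congr rfl h]
  -- `A ℓ` says that the displacement first exceeds 2ε at time ℓ; `C ℓ` says that the remaining
  -- displacement is at most ε. They depend on disjoint sets of steps, and `C ℓ` has probability at
  -- least 1/2.
  let A (ℓ : ℕ) : Set (ℕ → Circle) := {ξ | 2 * ε < D ℓ ξ ∧ ∀ j < ℓ, D j ξ ≤ 2 * ε}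
  let C (ℓ : ℕ) : Set (ℕ → Circle) := {ξ | dist (∏ r ∈ Finset.Ioc (s + ℓ) (s + L), ξ r) 1 ≤ ε}
  have hA : ∀ ℓ, MeasurableSet (A ℓ) := fun ℓ => by
    have h' : A ℓ = {ξ | 2 * ε < D ℓ ξ} ∩ ⋂ j, ⋂ _ : j < ℓ, {ξ | D j ξ ≤ 2 * ε} := by
      ext; simp [A]
    rw [h']
    exact (measurableSet_lt measurable_const (hD ℓ)).inter <| MeasurableSet.iInter fun j =>
      MeasurableSet.iInter fun _ => measurableSet_le (hD j) measurable_const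
  have hC : ∀ ℓ, MeasurableSet (C ℓ) := fun ℓ =>
    measurableSet_le ((measurable_prod_block _).dist measurable_const) measurable_const
  have hAC : ∀ ℓ ≤ L, steps β (A ℓ) ≤ 2 * steps β (A ℓ ∩ C ℓ) := fun ℓ hℓ => by
    have hdisj : Disjoint (Finset.Ioc s (s + ℓ)) (Finset.Ioc (s + ℓ) (s + L)) := by
      rw [Finset.disjoint_left]; intro r; simp only [Finset.mem_Ioc]; omega
    rw [steps_inter_eq_mul β hdisj (hA ℓ) (hC ℓ)]
    · calc steps β (A ℓ) = steps β (A ℓ) * (2 * (1 / 2)) := by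
            rw [one_div, ENNReal.mul_inv_cancel (by simp) (by simp), mul_one]
        _ ≤ steps β (A ℓ) * (2 * steps β (C ℓ)) := by gcongr; exact h ℓ hℓ
        _ = _ := by ring
    · intro ξ η hξ
      have hj : ∀ j ≤ ℓ, D j ξ = D j η := fun j hj => hDdep j ξ η fun r hr => hξ r (by
        simp only [Finset.mem_Ioc] at hr ⊢; omega)
      simp only [A, mem_ofPred_eq]
      rw [hj ℓ le_rfl]
      exact and_congr_right fun _ => forall₂_congr fun j hjl => by rw [hj j hjl.le]
    · intro ξ η hξ
      simp only [C, mem_ofPred_eq]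
      rw [Finset.prod_congr rfl hξ]
  have hAdisj : Pairwise (Function.onFun Disjoint A) := by
    intro i j hij
    refine Set.disjoint_left.2 fun ξ hi hj => ?_
    rcases lt_or_gt_of_ne hij with hlt | hlt
    · exact absurd hi.1 (not_lt.2 (hj.2 i hlt))
    · exact absurd hj.1 (not_lt.2 (hi.2 j hlt))
  have hcover : {ξ | ∃ ℓ ≤ L, 2 * ε < dist (walk ξ (s + ℓ)) (walk ξ s)}
      ⊆ ⋃ ℓ ∈ Finset.range (L + 1), A ℓ := by
    rintro ξ ⟨ℓ, hℓ, hlt⟩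
    rw [dist_walk_add] at hlt
    classical
    have hex : ∃ j, 2 * ε < D j ξ := ⟨ℓ, hlt⟩
    refine mem_biUnion (x := Nat.find hex) ?_ ⟨Nat.find_spec hex, fun j hj =>
      not_lt.1 (Nat.find_min hex hj)⟩
    have := Nat.find_min' hex hlt
    simp only [Finset.coe_range, mem_Iio]
    omega
  have hsub : (⋃ ℓ ∈ Finset.range (L + 1), A ℓ ∩ C ℓ)
      ⊆ {ξ | ε < dist (∏ r ∈ Finset.Ioc s (s + L), ξ r) 1} := by
    refine iUnion₂_subset fun ℓ hℓ ξ hξ => ?_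
    have hℓ' : ℓ ≤ L := by simpa [Nat.lt_succ_iff] using hℓ
    have h1 : 2 * ε < D ℓ ξ := hξ.1.1
    have h2 : dist (∏ r ∈ Finset.Ioc (s + ℓ) (s + L), ξ r) 1 ≤ ε := hξ.2
    obtain ⟨p, rfl⟩ := Nat.exists_eq_add_of_le hℓ'
    have e1 := dist_walk_add ξ s ℓ
    have e2 := dist_walk_add ξ (s + ℓ) p
    have e3 := dist_walk_add ξ s (ℓ + p)
    rw [add_assoc] at e2
    have tri := dist_triangle_left (walk ξ (s + ℓ)) (walk ξ s) (walk ξ (s + (ℓ + p)))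
    simp only [D] at h1
    simp only [mem_ofPred_eq]
    linarith
  calc _ ≤ steps β (⋃ ℓ ∈ Finset.range (L + 1), A ℓ) := measure_mono hcover
    _ ≤ ∑ ℓ ∈ Finset.range (L + 1), steps β (A ℓ) := measure_biUnion_finset_le _ _
    _ ≤ ∑ ℓ ∈ Finset.range (L + 1), 2 * steps β (A ℓ ∩ C ℓ) :=
        Finset.sum_le_sum fun ℓ hℓ => hAC ℓ (by simpa [Nat.lt_succ_iff] using hℓ)
    _ = 2 * steps β (⋃ ℓ ∈ Finset.range (L + 1), A ℓ ∩ C ℓ) := by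
        rw [← Finset.mul_sum, measure_biUnion_finset
          (fun i _ j _ hij => (hAdisj hij).mono inter_subset_left inter_subset_left)
          fun ℓ _ => (hA ℓ).inter (hC ℓ)]
    _ ≤ _ := by gcongr

/-- The (real) Fourier coefficient of the von Mises law. -/
def rho (β : ℝ) (k : ℤ) : ℝ := (vonMisesCoeff β k).re

theorem vonMisesCoeff_eq_rho (β : ℝ) (k : ℤ) : vonMisesCoeff β k = rho β k := by
  rw [rho, vonMisesCoeff_eq, Complex.ofReal_re]

theorem rho_le_one (β : ℝ) (k : ℤ) : rho β k ≤ 1 := by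
  refine (Complex.re_le_norm _).trans ?_
  refine (norm_integral_le_of_norm_le_const (C := 1) (Eventually.of_forall fun z => ?_)).trans ?_
  · rw [Circle.norm_coe]
  · simp

theorem dist_one_sq (z : Circle) : dist z 1 ^ 2 = 2 - 2 * ((z ^ (1 : ℤ) : Circle) : ℂ).re := by
  have h := Circle.normSq_coe z
  rw [Complex.normSq_apply] at h
  rw [dist_circle, ← Complex.normSq_eq_norm_sq, Complex.normSq_apply]
  simp
  linear_combination h

/-- Square 2 - 2 Re z and use 2 (Re z)² = 1 + Re z². Being linear in Fourier modes, the fourth power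
has an exact expectation in terms of `rho`. -/
theorem dist_one_pow_four (z : Circle) : dist z 1 ^ 4
    = 6 - 8 * ((z ^ (1 : ℤ) : Circle) : ℂ).re + 2 * ((z ^ (2 : ℤ) : Circle) : ℂ).re := by
  have h := Circle.normSq_coe z
  rw [Complex.normSq_apply] at h
  rw [show dist z 1 ^ 4 = (dist z 1 ^ 2) ^ 2 by ring, dist_one_sq]
  have h2 : ((z ^ (2 : ℤ) : Circle) : ℂ).re
      = (z : ℂ).re * (z : ℂ).re - (z : ℂ).im * (z : ℂ).im := by
    rw [zpow_ofNat, pow_two, Circle.coe_mul, Complex.mul_re]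
  rw [h2, zpow_one]
  linear_combination 2 * h

theorem integrable_prod_block_zpow (β : ℝ) (B : Finset ℕ) (k : ℤ) :
    Integrable (fun ξ : ℕ → Circle => (((∏ r ∈ B, ξ r) ^ k : Circle) : ℂ)) (steps β) :=
  Integrable.of_bound
    ((continuous_circle_zpow k).measurable.comp (measurable_prod_block B)).aestronglyMeasurable 1
    (Eventually.of_forall fun _ => (Circle.norm_coe _).le)

theorem integral_prod_block_zpow_re (β : ℝ) {B : Finset ℕ} (hB : 0 ∉ B) (k : ℤ) :
    ∫ ξ, (((∏ r ∈ B, ξ r) ^ k : Circle) : ℂ).re ∂(steps β) = rho β k ^ B.card := by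
  have h := integral_prod_block_zpow β hB k
  have h2 := integral_re (integrable_prod_block_zpow β B k)
  simp only [RCLike.re_to_complex] at h2
  rw [h2, h, vonMisesCoeff_eq_rho]
  norm_cast

theorem measureReal_dist_sq_le (β : ℝ) {B : Finset ℕ} (hB : 0 ∉ B) {ε : ℝ} (hε : 0 < ε) :
    (steps β).real {ξ | ε < dist (∏ r ∈ B, ξ r) 1} ≤ (2 - 2 * rho β 1 ^ B.card) / ε ^ 2 := by
  have hi := (integrable_prod_block_zpow β B 1).re
  simp only [RCLike.re_to_complex] at hi
  have h := mul_meas_ge_le_integral_of_nonneg (μ := steps β)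
    (f := fun ξ => dist (∏ r ∈ B, ξ r) 1 ^ 2)
    (Eventually.of_forall fun ξ => by positivity)
    (by simp_rw [dist_one_sq]; exact (integrable_const _).sub (hi.const_mul 2)) (ε ^ 2)
  simp_rw [dist_one_sq] at h
  rw [integral_sub (integrable_const _) (hi.const_mul 2), integral_const_mul,
    integral_prod_block_zpow_re β hB, integral_const, probReal_univ, one_smul] at h
  rw [le_div_iff₀ (by positivity), mul_comm]
  refine le_trans ?_ h
  refine mul_le_mul_of_nonneg_left (measureReal_mono fun ξ hξ => ?_) (by positivity)
  simp only [mem_ofPred_eq] at hξ ⊢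
  rw [← dist_one_sq]
  gcongr

/-- The fourth moment is used because the second-moment bound is only O(1/m) per block, and its sum
over m + 1 blocks would not vanish. -/
theorem measureReal_dist_four_le (β : ℝ) {B : Finset ℕ} (hB : 0 ∉ B) {ε : ℝ} (hε : 0 < ε) :
    (steps β).real {ξ | ε < dist (∏ r ∈ B, ξ r) 1}
      ≤ (6 - 8 * rho β 1 ^ B.card + 2 * rho β 2 ^ B.card) / ε ^ 4 := by
  have hi := (integrable_prod_block_zpow β B 1).re
  have hj := (integrable_prod_block_zpow β B 2).re
  simp only [RCLike.re_to_complex] at hi hj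
  have hint := ((integrable_const (6 : ℝ)).sub (hi.const_mul 8)).add (hj.const_mul 2)
  have h := mul_meas_ge_le_integral_of_nonneg (μ := steps β)
    (f := fun ξ => dist (∏ r ∈ B, ξ r) 1 ^ 4)
    (Eventually.of_forall fun ξ => by positivity)
    (by simp_rw [dist_one_pow_four]; exact hint) (ε ^ 4)
  simp_rw [dist_one_pow_four] at h
  have hsub : Integrable (fun ξ : ℕ → Circle =>
      6 - 8 * (((∏ r ∈ B, ξ r) ^ (1 : ℤ) : Circle) : ℂ).re) (steps β) :=
    (integrable_const (6 : ℝ)).sub (hi.const_mul 8)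
  rw [integral_add hsub (hj.const_mul 2), integral_sub (integrable_const _) (hi.const_mul 8),
    integral_const_mul, integral_const_mul,
    integral_prod_block_zpow_re β hB, integral_prod_block_zpow_re β hB, integral_const,
    probReal_univ, one_smul] at h
  rw [le_div_iff₀ (by positivity), mul_comm]
  refine le_trans ?_ h
  refine mul_le_mul_of_nonneg_left (measureReal_mono fun ξ hξ => ?_) (by positivity)
  simp only [mem_ofPred_eq] at hξ ⊢
  rw [← dist_one_pow_four]
  gcongr

/-- The maximal displacement of the walk over a block of length `L`. -/
theorem measureReal_max_block_le {β : ℝ} {s L : ℕ} {ε : ℝ} (hε : 0 < ε) (hρ : 0 ≤ rho β 1)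
    (hL : (2 - 2 * rho β 1 ^ L) / ε ^ 2 ≤ 1 / 2) :
    (steps β).real {ξ | ∃ ℓ ≤ L, 2 * ε < dist (walk ξ (s + ℓ)) (walk ξ s)}
      ≤ 2 * ((6 - 8 * rho β 1 ^ L + 2 * rho β 2 ^ L) / ε ^ 4) := by
  have h := ottaviani β s L ε fun ℓ hℓ => by
    set B := Finset.Ioc (s + ℓ) (s + L)
    have hc : B.card ≤ L := by simp [B]; omega
    have h1 := measureReal_dist_sq_le β (B := B) (by simp [B]) hε
    -- Since 0 ≤ `rho β 1` ≤ 1, the second-moment bound for the full block also covers every final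
    -- piece of it, as Ottaviani's inequality requires.
    have h2 : (2 - 2 * rho β 1 ^ B.card) / ε ^ 2 ≤ 1 / 2 := by
      refine le_trans ?_ hL
      gcongr ?_ / _
      linarith [pow_le_pow_of_le_one hρ (rho_le_one β 1) hc]
    have hm : MeasurableSet {ξ : ℕ → Circle | dist (∏ r ∈ B, ξ r) 1 ≤ ε} :=
      measurableSet_le ((measurable_prod_block _).dist measurable_const) measurable_const
    have h3 := probReal_compl_eq_one_sub (μ := steps β) hm
    have h4 : {ξ : ℕ → Circle | dist (∏ r ∈ B, ξ r) 1 ≤ ε}ᶜ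
        = {ξ | ε < dist (∏ r ∈ B, ξ r) 1} := by ext; simp
    rw [h4] at h3
    have h5 : 1 / 2 ≤ (steps β).real {ξ : ℕ → Circle | dist (∏ r ∈ B, ξ r) 1 ≤ ε} := by linarith
    have h6 := ENNReal.ofReal_le_ofReal h5
    rw [ofReal_measureReal] at h6
    refine le_trans (le_of_eq ?_) h6
    rw [ENNReal.ofReal_div_of_pos (by norm_num)]
    simp
  have h7 := ENNReal.toReal_mono (by finiteness) h
  rw [ENNReal.toReal_mul] at h7
  refine h7.trans ?_
  have h8 := measureReal_dist_four_le β (B := Finset.Ioc s (s + L)) (by simp) hε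
  simp only [Nat.card_Ioc, add_tsub_cancel_left] at h8
  rw [ENNReal.toReal_ofNat]
  gcongr
  exact h8

/-! ### Oscillation of the paths between grid times. -/

/-- The extra 1 in the block length `n / m + 1` absorbs the rounding of both natural-number
divisions. -/
theorem floor_block_bounds {n m : ℕ} (hm : 0 < m) {t : ℝ} (ht : 0 ≤ t) :
    n * ⌊(m : ℝ) * t⌋₊ / m ≤ ⌊(n : ℝ) * t⌋₊ ∧
      ⌊(n : ℝ) * t⌋₊ ≤ n * ⌊(m : ℝ) * t⌋₊ / m + (n / m + 1) := by
  have hm' : (0 : ℝ) < m := by exact_mod_cast hm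
  set j := ⌊(m : ℝ) * t⌋₊
  set k := ⌊(n : ℝ) * t⌋₊
  have hj : (j : ℝ) ≤ m * t := Nat.floor_le (by positivity)
  have hj' : (m : ℝ) * t < j + 1 := Nat.lt_floor_add_one _
  have hk : (k : ℝ) ≤ n * t := Nat.floor_le (by positivity)
  constructor
  · refine Nat.le_floor (Nat.cast_div_le.trans ?_)
    rw [div_le_iff₀ hm']
    push_cast
    nlinarith [mul_le_mul_of_nonneg_left hj n.cast_nonneg (α := ℝ)]
  · have h1 : k * m ≤ n * (j + 1) := by
      have : (k : ℝ) * m ≤ n * (j + 1) := by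
        nlinarith [mul_le_mul_of_nonneg_right hk hm'.le,
          mul_le_mul_of_nonneg_left hj'.le n.cast_nonneg (α := ℝ)]
      exact_mod_cast this
    have h2 := Nat.div_add_mod (n * j) m
    have h3 := Nat.div_add_mod n m
    have h4 := Nat.mod_lt (n * j) hm
    have h5 := Nat.mod_lt n hm
    have h6 : k * m < (n * j / m + (n / m + 2)) * m := by nlinarith
    have := Nat.lt_of_mul_lt_mul_right h6
    omega

/-- The event that the path moves by more than `2 * ε` from its last grid value. -/
def oscillates (n m : ℕ) (ε : ℝ) : Set (ℕ → Circle) :=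
  {ξ | ∃ t : I, 2 * ε < dist (walk ξ (site n t)) (walk ξ (n * (site m t) / m))}

theorem measureReal_oscillates_le {β : ℝ} {n m : ℕ} (hm : 0 < m) {ε : ℝ} (hε : 0 < ε)
    (hρ : 0 ≤ rho β 1) (hL : (2 - 2 * rho β 1 ^ (n / m + 1)) / ε ^ 2 ≤ 1 / 2) :
    (steps β).real (oscillates n m ε)
      ≤ (m + 1) * (2 * ((6 - 8 * rho β 1 ^ (n / m + 1) + 2 * rho β 2 ^ (n / m + 1)) / ε ^ 4)) := by
  have hsub : oscillates n m ε ⊆ ⋃ j ∈ Finset.range (m + 1),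
      {ξ | ∃ ℓ ≤ n / m + 1, 2 * ε < dist (walk ξ (n * j / m + ℓ)) (walk ξ (n * j / m))} := by
    rintro ξ ⟨t, ht⟩
    obtain ⟨h1, h2⟩ := floor_block_bounds (n := n) hm t.2.1
    refine mem_biUnion (x := (site m t : ℕ)) (by simpa using (site m t).2)
      ⟨site n t - n * (site m t) / m, ?_, ?_⟩
    · simp only [site]; omega
    · rw [Nat.add_sub_cancel' (by simpa only [site] using h1)]
      exact ht
  refine (measureReal_mono hsub (measure_ne_top _ _)).trans
    ((measureReal_biUnion_finset_le _ _).trans ?_)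
  refine (Finset.sum_le_sum fun j _ => measureReal_max_block_le hε hρ hL).trans ?_
  simp

theorem tendsto_rho_pow {β : ℕ → ℝ} {b : ℝ} (hb : 0 < b)
    (hβ : Tendsto (fun n : ℕ => β n / (n : ℝ)) atTop (𝓝 b)) (k : ℤ) {ℓ : ℕ → ℕ} {τ : ℝ}
    (hℓ : Tendsto (fun n : ℕ => (ℓ n : ℝ) / n) atTop (𝓝 τ)) :
    Tendsto (fun n => rho (β n) k ^ ℓ n) atTop (𝓝 (Real.exp (-(k ^ 2 * τ / (2 * b))))) := by
  have h := tendsto_vonMisesCoeff_pow hb hβ k hℓ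
  simp_rw [vonMisesCoeff_eq_rho] at h
  have h2 := (Complex.continuous_re.tendsto _).comp h
  have h3 : (Complex.exp (-((k : ℂ) ^ 2 * τ / (2 * b)))).re
      = Real.exp (-(k ^ 2 * τ / (2 * b))) := by
    rw [← Complex.ofReal_re (Real.exp _)]; push_cast; rfl
  rw [h3] at h2
  refine h2.congr fun n => ?_
  simp only [Function.comp_apply]
  norm_cast

theorem tendsto_natDiv_div (j : ℕ) {m : ℕ} (hm : 0 < m) :
    Tendsto (fun n : ℕ => ((n * j / m : ℕ) : ℝ) / n) atTop (𝓝 (j / m)) := by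
  have h := (tendsto_nat_floor_mul_div_atTop (R := ℝ) (a := (j : ℝ) / m) (by positivity)).comp
    tendsto_natCast_atTop_atTop
  refine h.congr fun n => ?_
  simp only [Function.comp_apply]
  congr 2
  rw [← Nat.floor_div_eq_div (K := ℝ)]
  congr 1
  push_cast
  ring

/-- With q = exp(-u), the left side factors as 2(1 - q)²(q² + 2q + 3): the first-order term in u
cancels, and the last factor is at most 6. -/
theorem exp_combination_le {u : ℝ} (hu : 0 ≤ u) :
    6 - 8 * Real.exp (-u) + 2 * Real.exp (-(4 * u)) ≤ 12 * u ^ 2 := by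
  have h4 : Real.exp (-(4 * u)) = Real.exp (-u) ^ 4 := by
    rw [← Real.exp_nat_mul]; congr 1; push_cast; ring
  rw [h4]
  set q := Real.exp (-u)
  have hq : 0 < q := Real.exp_pos _
  have hq1 : q ≤ 1 := Real.exp_le_one_iff.2 (by linarith)
  have hqu : 1 - q ≤ u := by linarith [Real.add_one_le_exp (-u)]
  calc 6 - 8 * q + 2 * q ^ 4 = 2 * (1 - q) ^ 2 * (q ^ 2 + 2 * q + 3) := by ring
    _ ≤ 2 * (1 - q) ^ 2 * 6 := by gcongr; nlinarith
    _ ≤ 2 * u ^ 2 * 6 := by gcongr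
    _ = _ := by ring

/-- Asymptotic equicontinuity of the paths. -/
theorem eventually_measureReal_oscillates_lt {β : ℕ → ℝ} {b : ℝ} (hb : 0 < b)
    (hβ : Tendsto (fun n : ℕ => β n / (n : ℝ)) atTop (𝓝 b)) {ε δ : ℝ} (hε : 0 < ε) (hδ : 0 < δ) :
    ∀ᶠ m : ℕ in atTop, ∀ᶠ n : ℕ in atTop, (steps (β n)).real (oscillates n m ε) < δ := by
  -- Over one block the first and second coefficients tend to exp(-u) and exp(-4u).
  let u (m : ℕ) : ℝ := 1 / (2 * b) / m
  have hu0 : Tendsto u atTop (𝓝 0) := tendsto_const_div_atTop_nhds_zero_nat _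
  have hv : Tendsto (fun m : ℕ => ((m : ℝ) + 1) * u m) atTop (𝓝 (1 / (2 * b))) := by
    have h1 : Tendsto (fun m : ℕ => 1 / (2 * b) + u m) atTop (𝓝 (1 / (2 * b) + 0)) :=
      hu0.const_add _
    rw [add_zero] at h1
    refine h1.congr' ?_
    filter_upwards [eventually_ne_atTop 0] with m hm
    have : (m : ℝ) ≠ 0 := by exact_mod_cast hm
    simp only [u]; field_simp
  -- 24 is the 2 from Ottaviani times the 12 of `exp_combination_le`. One factor u is absorbed by
  -- the number of blocks, and the other tends to 0.
  have hbound : Tendsto (fun m : ℕ => ((m : ℝ) + 1) * u m * (24 * u m / ε ^ 4)) atTop (𝓝 0) := by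
    have h1 := hv.mul ((hu0.const_mul 24).div_const (ε ^ 4))
    simpa using h1
  have hhalf : Tendsto (fun m : ℕ => 2 * u m / ε ^ 2) atTop (𝓝 0) := by
    have h1 := (hu0.const_mul 2).div_const (ε ^ 2)
    simpa using h1
  filter_upwards [hbound.eventually_lt_const hδ, hhalf.eventually_lt_const one_half_pos,
    eventually_gt_atTop 0] with m hm1 hm2 hm
  have hmR : (0 : ℝ) < m := by exact_mod_cast hm
  have hum : 0 ≤ u m := by positivity
  have hℓ : Tendsto (fun n : ℕ => ((n / m + 1 : ℕ) : ℝ) / n) atTop (𝓝 (1 / m)) := by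
    have h1 := (tendsto_natDiv_div 1 hm).add (tendsto_one_div_atTop_nhds_zero_nat (𝕜 := ℝ))
    simp only [mul_one, Nat.cast_one, add_zero] at h1
    refine h1.congr fun n => ?_
    push_cast; ring
  have h1 : Tendsto (fun n => rho (β n) 1 ^ (n / m + 1)) atTop (𝓝 (Real.exp (-u m))) := by
    convert tendsto_rho_pow hb hβ 1 hℓ using 4
    simp only [u]; push_cast; field_simp
  have h2 : Tendsto (fun n => rho (β n) 2 ^ (n / m + 1)) atTop (𝓝 (Real.exp (-(4 * u m)))) := by
    convert tendsto_rho_pow hb hβ 2 hℓ using 4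
    simp only [u]; push_cast; field_simp; norm_num
  -- The constant exponent 1 has τ = 0, so `rho` tends to 1 and is eventually positive.
  have h3 : Tendsto (fun n => rho (β n) 1) atTop (𝓝 1) := by
    have := tendsto_rho_pow hb hβ 1 (ℓ := fun _ => 1) (τ := 0)
      (by simpa using tendsto_one_div_atTop_nhds_zero_nat (𝕜 := ℝ))
    simpa using this
  have hlim1 := ((h1.const_mul 2).const_sub 2).div_const (ε ^ 2)
  have hlt1 : (2 - 2 * Real.exp (-u m)) / ε ^ 2 < 1 / 2 := by
    refine lt_of_le_of_lt ?_ hm2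
    gcongr
    linarith [Real.add_one_le_exp (-u m)]
  have hlim2 := (((((h1.const_mul 8).const_sub 6).add (h2.const_mul 2)).div_const
    (ε ^ 4)).const_mul 2).const_mul ((m : ℝ) + 1)
  have hlt2 : ((m : ℝ) + 1) * (2 * ((6 - 8 * Real.exp (-u m) + 2 * Real.exp (-(4 * u m))) / ε ^ 4))
      < δ := by
    refine lt_of_le_of_lt ?_ hm1
    calc _ ≤ ((m : ℝ) + 1) * (2 * (12 * u m ^ 2 / ε ^ 4)) := by
          gcongr; exact exp_combination_le hum
      _ = _ := by ring
  filter_upwards [hlim1.eventually_lt_const hlt1, hlim2.eventually_lt_const hlt2,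
    h3.eventually_const_lt one_pos] with n hn1 hn2 hn3
  exact (measureReal_oscillates_le hm hε hn3.le hn1.le).trans_lt hn2

end XYChain

namespace CadlagPath

/-! ### Càdlàg paths: comparison with the uniform distance, and continuity read off rational times.
-/

/-- The Skorohod distance is at most the uniform distance. -/
theorem edist_le_of_forall_edist_le {E : Type*} [PseudoEMetricSpace E] {x y : CadlagPath E}
    {c : ℝ≥0∞} (h : ∀ t, edist (x t) (y t) ≤ c) : edist x y ≤ c :=
  (iInf_le _ (OrderIso.refl I)).trans (max_le (by simp) (iSup_le fun t => by simpa using h t))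

/-- The least multiple of `1 / (n + 1)` above `t`. -/
def ceilGrid (n : ℕ) (t : I) : I :=
  ⟨⌈((n + 1 : ℕ) : ℝ) * t⌉₊ / (n + 1 : ℕ), by positivity, by
    rw [div_le_one (by positivity)]
    exact_mod_cast Nat.ceil_le.2 (mul_le_of_le_one_right (by positivity) t.2.2)⟩

theorem le_ceilGrid (n : ℕ) (t : I) : t ≤ ceilGrid n t := by
  rw [← Subtype.coe_le_coe, ceilGrid, le_div_iff₀ (by positivity), mul_comm]
  exact Nat.le_ceil _

theorem tendsto_ceilGrid (t : I) : Tendsto (fun n => ceilGrid n t) atTop (𝓝 t) := by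
  rw [tendsto_subtype_rng]
  exact ((tendsto_nat_ceil_mul_div_atTop (R := ℝ) t.2.1).comp
    (tendsto_natCast_atTop_atTop.comp (tendsto_add_atTop_nat 1))).congr fun n => by
      simp [ceilGrid, mul_comm]

/-- The rational points of the unit interval. -/
def ratPoints : Set I := {t | ∃ q : ℚ, (q : ℝ) = t}

theorem countable_ratPoints : ratPoints.Countable := by
  have : ratPoints = Subtype.val ⁻¹' range ((↑) : ℚ → ℝ) := rfl
  rw [this]
  exact (countable_range _).preimage Subtype.val_injective

theorem ceilGrid_mem (n : ℕ) (t : I) : ceilGrid n t ∈ ratPoints :=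
  ⟨⌈((n + 1 : ℕ) : ℝ) * t⌉₊ / (n + 1 : ℕ), by simp [ceilGrid]⟩

/-- The rational approximations come from the right, where a càdlàg path is continuous. -/
theorem tendsto_comp_ceilGrid {E : Type*} [TopologicalSpace E] (x : CadlagPath E) (t : I) :
    Tendsto (fun n => x (ceilGrid n t)) atTop (𝓝 (x t)) :=
  (x.right_continuous t).tendsto.comp (tendsto_nhdsWithin_iff.2
    ⟨tendsto_ceilGrid t, Eventually.of_forall fun n => le_ceilGrid n t⟩)

/-- Functions that are uniformly continuous on the rational points. -/
def ratUniform (E : Type*) [PseudoMetricSpace E] : Set (I → E) :=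
  {z | ∀ p : ℕ, ∃ q : ℕ, ∀ s ∈ ratPoints, ∀ t ∈ ratPoints,
    dist s t < 1 / ((q : ℝ) + 1) → dist (z s) (z t) ≤ 1 / ((p : ℝ) + 1)}

/-- Uniform continuity on countably many times is an event of the product σ-algebra on `I → E`, so
it passes between identically distributed processes; continuity on all of `I` is not such an event
in general. -/
theorem measurableSet_ratUniform (E : Type*) [PseudoMetricSpace E] [SecondCountableTopology E]
    [MeasurableSpace E] [OpensMeasurableSpace E] : MeasurableSet (ratUniform E) := by
  have h : ratUniform E = ⋂ p : ℕ, ⋃ q : ℕ, ⋂ s ∈ ratPoints, ⋂ t ∈ ratPoints,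
      {z : I → E | dist s t < 1 / ((q : ℝ) + 1) → dist (z s) (z t) ≤ 1 / ((p : ℝ) + 1)} := by
    ext; simp only [ratUniform, mem_iInter, mem_iUnion, mem_ofPred_eq]
  rw [h]
  refine MeasurableSet.iInter fun p => MeasurableSet.iUnion fun q =>
    MeasurableSet.biInter countable_ratPoints fun s _ =>
    MeasurableSet.biInter countable_ratPoints fun t _ => ?_
  by_cases hst : dist s t < 1 / ((q : ℝ) + 1)
  · simp only [hst, true_imp_iff]
    exact measurableSet_le ((measurable_pi_apply s).dist (measurable_pi_apply t)) measurable_const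
  · simp only [hst, false_imp_iff]
    exact MeasurableSet.univ

theorem mem_ratUniform_of_continuous {E : Type*} [PseudoMetricSpace E] {z : I → E}
    (hz : Continuous z) : z ∈ ratUniform E := by
  intro p
  obtain ⟨δ, hδ, h⟩ := Metric.uniformContinuous_iff.1
    (CompactSpace.uniformContinuous_of_continuous hz) (1 / ((p : ℝ) + 1)) (by positivity)
  obtain ⟨q, hq⟩ := exists_nat_one_div_lt hδ
  exact ⟨q, fun s _ t _ hst => (h (hst.trans hq)).le⟩

theorem continuous_of_mem_ratUniform {E : Type*} [PseudoMetricSpace E] {x : CadlagPath E}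
    (hx : x.toFun ∈ ratUniform E) : Continuous x.toFun := by
  refine UniformContinuous.continuous (Metric.uniformContinuous_iff.2 fun ε hε => ?_)
  obtain ⟨p, hp⟩ := exists_nat_one_div_lt hε
  obtain ⟨q, hq⟩ := hx p
  refine ⟨1 / ((q : ℝ) + 1), by positivity, fun {s t} hst => lt_of_le_of_lt ?_ hp⟩
  refine le_of_tendsto ((x.tendsto_comp_ceilGrid s).dist (x.tendsto_comp_ceilGrid t)) ?_
  filter_upwards [((tendsto_ceilGrid s).dist (tendsto_ceilGrid t)).eventually_lt_const hst]
    with n hn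
  exact hq _ (ceilGrid_mem n s) _ (ceilGrid_mem n t) hn

end CadlagPath

namespace XYChain

/-! ### Step-function interpolation on a grid. -/

theorem lipschitzWith_spinPath (m : ℕ) : LipschitzWith 1 (spinPath m) :=
  LipschitzWith.of_edist_le fun x y => CadlagPath.edist_le_of_forall_edist_le fun t =>
    edist_le_pi_edist x y (site m t)

/-- The point `j / m` of the unit interval. -/
def gridPoint (m : ℕ) (j : Fin (m + 1)) : I :=
  ⟨(j : ℕ) / m, by positivity,
    div_le_one_of_le₀ (by exact_mod_cast Nat.lt_succ_iff.1 j.2) (by positivity)⟩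

theorem dist_gridPoint_site_le {m : ℕ} (hm : 0 < m) (t : I) :
    dist (gridPoint m (site m t)) t ≤ 1 / m := by
  have hm' : (0 : ℝ) < m := by exact_mod_cast hm
  rw [Subtype.dist_eq, Real.dist_eq, abs_le]
  have h1 : (⌊(m : ℝ) * t⌋₊ : ℝ) ≤ m * t := Nat.floor_le (mul_nonneg hm'.le t.2.1)
  have h2 : (m : ℝ) * t < ⌊(m : ℝ) * t⌋₊ + 1 := Nat.lt_floor_add_one _
  have h3 : ((gridPoint m (site m t) : I) : ℝ) - t = (⌊(m : ℝ) * t⌋₊ - m * t) / m := by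
    simp only [gridPoint, site]; field_simp
  rw [h3, ← neg_div]
  constructor <;> gcongr <;> linarith

/-- Step-function interpolations of a continuous path converge to it. -/
theorem tendsto_spinPath_gridPoint {x : CadlagPath Circle} (hx : Continuous x.toFun) :
    Tendsto (fun m => spinPath m fun j => x (gridPoint m j)) atTop (𝓝 x) := by
  rw [EMetric.tendsto_nhds]
  intro ε hε
  obtain ⟨ε', hε', hlt⟩ := exists_between hε
  obtain ⟨δ, hδ, h⟩ := EMetric.uniformContinuous_iff.1
    (CompactSpace.uniformContinuous_of_continuous hx) ε' hε'
  have h0 : Tendsto (fun m : ℕ => ENNReal.ofReal (1 / m)) atTop (𝓝 0) := by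
    simpa using ENNReal.tendsto_ofReal (tendsto_one_div_atTop_nhds_zero_nat (𝕜 := ℝ))
  filter_upwards [h0.eventually_lt_const hδ, eventually_gt_atTop 0] with m hm hm0
  refine lt_of_le_of_lt (CadlagPath.edist_le_of_forall_edist_le fun t => (h ?_).le) hlt
  refine lt_of_le_of_lt ?_ hm
  rw [edist_dist]
  exact ENNReal.ofReal_le_ofReal (dist_gridPoint_site_le hm0 t)

theorem circle_exp_zpow (x : ℝ) (k : ℤ) :
    ((Circle.exp x ^ k : Circle) : ℂ) = Complex.exp (((k * x : ℝ) : ℂ) * Complex.I) := by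
  rw [Circle.coe_zpow, Circle.coe_exp, ← Complex.exp_int_mul]
  push_cast; ring_nf

/-! ### Fourier coefficients of the Brownian increments on the circle. -/

section Brownian

variable {Ω : Type*} [MeasurableSpace Ω] {P : Measure Ω}
  {B : NNReal → Ω → ℝ} {b : ℝ}

theorem integral_exp_brownian_increment (hB : IsBrownianReal B P) (hb : 0 < b) (s t : NNReal)
    (k : ℤ) : ∫ ω, ((Circle.exp ((B s ω - B t ω) / √b) ^ k : Circle) : ℂ) ∂P
      = Complex.exp (-(k ^ 2 * (nndist s.1 t.1 : ℝ) / (2 * b))) := by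
  have hsq : ((√b : ℝ) : ℂ) ^ 2 = b := by exact_mod_cast Real.sq_sqrt hb.le
  have hb' : (b : ℂ) ≠ 0 := by exact_mod_cast hb.ne'
  have h := (hB.hasLaw_sub s t).integral_comp
    (f := fun x : ℝ => Complex.exp (((k / √b : ℝ) : ℂ) * x * Complex.I))
    (Continuous.aestronglyMeasurable (by fun_prop))
  rw [← charFun_apply_real, charFun_gaussianReal] at h
  calc _ = _ := by
        congr 1; ext ω
        rw [circle_exp_zpow]
        simp only [Function.comp_apply, Pi.sub_apply]
        push_cast; ring_nf
    _ = _ := h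
    _ = _ := by
        congr 1
        push_cast
        rw [div_pow, hsq]
        field_simp
        ring

/-- The increments over the grid of a function on the unit interval. -/
def gridIncrement (m : ℕ) (z : I → Circle) (i : Fin m) : Circle :=
  z (gridPoint m i.succ) / z (gridPoint m i.castSucc)

theorem measurable_gridIncrement (m : ℕ) (i : Fin m) :
    Measurable fun z : I → Circle => gridIncrement m z i :=
  (measurable_pi_apply _).div (measurable_pi_apply _)

theorem measurable_torusChar_gridIncrement (m : ℕ) (k : Fin m → ℤ) :
    Measurable fun z : I → Circle => torusChar k (gridIncrement m z) :=
  (torusChar k).continuous.measurable.comp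
    (measurable_pi_iff.2 fun i => measurable_gridIncrement m i)

theorem torusChar_eq_prod {ι : Type*} [Fintype ι] (k : ι → ℤ) (x : ι → Circle) :
    torusChar k x = ∏ i, ((x i ^ k i : Circle) : ℂ) := circle_coe_prod _ _

theorem integral_torusChar_brownian [IsProbabilityMeasure P] (hB : IsBrownianReal B P)
    (hb : 0 < b) {m : ℕ}
    (k : Fin m → ℤ) :
    ∫ ω, torusChar k (gridIncrement m fun t => Circle.exp (B (unitInterval.toNNReal t) ω / √b)) ∂P
      = ∏ i, Complex.exp (-((k i : ℂ) ^ 2 * ((1 / m : ℝ) : ℂ) / (2 * b))) := by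
  rcases Nat.eq_zero_or_pos m with rfl | hm
  · simp [torusChar_eq_prod]
  have hm' : (0 : ℝ) < m := by exact_mod_cast hm
  let τ : Fin (m + 1) → NNReal := fun j => unitInterval.toNNReal (gridPoint m j)
  have hτ : Monotone τ := fun i j hij => by
    change ((i : ℕ) : ℝ) / m ≤ ((j : ℕ) : ℝ) / m
    gcongr
    exact hij
  have hind := (hB.hasIndepIncrements m τ hτ).comp
    (fun i x => ((Circle.exp (x / √b) ^ k i : Circle) : ℂ))
    fun i => ((continuous_circle_zpow (k i)).comp (by fun_prop)).measurable
  have hmeas : ∀ i : Fin m, AEStronglyMeasurable ((fun x : ℝ =>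
      ((Circle.exp (x / √b) ^ k i : Circle) : ℂ)) ∘ fun ω => B (τ i.succ) ω - B (τ i.castSucc) ω)
      P := fun i =>
    (((continuous_circle_zpow (k i)).comp (by fun_prop)).measurable.comp_aemeasurable
      ((hB.aemeasurable _).sub (hB.aemeasurable _))).aestronglyMeasurable
  have h := hind.integral_fun_prod_eq_prod_integral hmeas
  calc _ = _ := by
        congr 1; ext ω
        rw [torusChar_eq_prod]
        refine Finset.prod_congr rfl fun i _ => ?_
        simp only [Function.comp_apply, gridIncrement, sub_div, Circle.exp_sub]
        rfl
    _ = _ := h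
    _ = _ := Finset.prod_congr rfl fun i _ => by
        refine (integral_exp_brownian_increment hB hb _ _ _).trans ?_
        congr 4
        have : ((τ i.succ).1 - (τ i.castSucc).1 : ℝ) = 1 / m := by
          change (((i.succ : Fin (m + 1)) : ℕ) : ℝ) / m - ((i.castSucc : Fin (m + 1)) : ℕ) / m = _
          simp only [Fin.val_succ, Fin.val_castSucc]
          push_cast; ring
        rw [coe_nndist, Real.dist_eq, this, abs_of_pos (by positivity)]

end Brownian

theorem map_circle_exp_of_isUniform {Ω : Type*} [MeasurableSpace Ω] {P : Measure Ω} {X : Ω → ℝ}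
    (hX : pdf.IsUniform X (Ico (-Real.pi) Real.pi) P volume) :
    P.map (fun ω => Circle.exp (X ω)) = uniformSpin := by
  have hpos : (volume (Ico (-Real.pi) Real.pi)) ≠ 0 := by simp [Real.pi_pos]
  have hXm := hX.aemeasurable hpos (by simp)
  have hexp : Measurable Circle.exp := Circle.exp.continuous.measurable
  have h1 : P.map (fun ω => Circle.exp (X ω)) = (P.map X).map Circle.exp :=
    (AEMeasurable.map_map_of_aemeasurable hexp.aemeasurable hXm).symm
  rw [h1, hX, ProbabilityTheory.cond, Measure.map_smul, Measure.restrict_congr_set Ico_ae_eq_Ioc,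
    uniformSpin, tilted_const', arcLength, Measure.map_apply hexp MeasurableSet.univ]
  simp

end XYChain

/-- The set A need not be measurable, as `oscillates` is an uncountable union over times; the
measurable hull replaces it at no cost in measure. -/
theorem abs_integral_le_add_mul_measureReal {Ω : Type*} [MeasurableSpace Ω] {μ : Measure Ω}
    [IsProbabilityMeasure μ] {h : Ω → ℝ} {A : Set Ω} {a C : ℝ} (ha : 0 ≤ a)
    (h1 : ∀ x ∉ A, |h x| ≤ a) (h2 : ∀ x, |h x| ≤ C) : |∫ x, h x ∂μ| ≤ a + C * μ.real A := by
  have hm := measurableSet_toMeasurable μ A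
  have hi : Integrable ((toMeasurable μ A).indicator fun _ => C) μ :=
    (integrable_const C).indicator hm
  have h3 : |∫ x, h x ∂μ| ≤ ∫ x, (a + (toMeasurable μ A).indicator (fun _ => C) x) ∂μ := by
    rw [← Real.norm_eq_abs]
    refine norm_integral_le_of_norm_le ((integrable_const a).add hi) (Eventually.of_forall
      fun x => ?_)
    rw [Real.norm_eq_abs]
    by_cases hx : x ∈ toMeasurable μ A
    · rw [indicator_of_mem hx]
      linarith [h2 x]
    · rw [indicator_of_notMem hx, add_zero]
      exact h1 x fun hA => hx (subset_toMeasurable μ A hA)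
  refine h3.trans (le_of_eq ?_)
  rw [integral_add (integrable_const a) hi, integral_indicator_const C hm]
  simp [measureReal_def, measure_toMeasurable, mul_comm]

namespace XYChain

/-! ### Finite-dimensional convergence and the limit path. -/

/-- Consecutive blocks of steps between the grid vertices `n * i / m`. -/
def blocks (n m : ℕ) : Fin (m + 1) → Finset ℕ :=
  Fin.cons {0} fun i : Fin m => Finset.Ioc (n * i / m) (n * (i + 1) / m)

theorem natDiv_mono (n m : ℕ) {i j : ℕ} (h : i ≤ j) : n * i / m ≤ n * j / m :=
  Nat.div_le_div_right (Nat.mul_le_mul_left n h)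

theorem pairwise_disjoint_blocks (n m : ℕ) : Pairwise (Function.onFun Disjoint (blocks n m)) := by
  have hlt : ∀ i j : Fin (m + 1), i < j → Disjoint (blocks n m i) (blocks n m j) := by
    intro i j hij
    obtain ⟨j, rfl⟩ := Fin.exists_succ_eq.2 (Fin.ne_zero_of_lt hij)
    rw [Finset.disjoint_left]
    intro r hi hj
    simp only [blocks, Fin.cons_succ, Finset.mem_Ioc] at hj
    rcases Fin.eq_zero_or_eq_succ i with rfl | ⟨i, rfl⟩
    · simp only [blocks, Fin.cons_zero, Finset.mem_singleton] at hi
      subst hi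
      exact absurd hj.1 (Nat.not_lt_zero _)
    · simp only [blocks, Fin.cons_succ, Finset.mem_Ioc] at hi
      have h1 : (i : ℕ) + 1 ≤ j := Fin.succ_lt_succ_iff.1 hij
      exact absurd (hi.2.trans (natDiv_mono n m h1)) (not_le.2 hj.1)
  intro i j hij
  rcases lt_or_gt_of_ne hij with h | h
  · exact hlt i j h
  · exact (hlt j i h).symm

theorem walk_eq_cumProd_blocks (n m : ℕ) (ξ : ℕ → Circle) :
    cumProd (m + 1) (fun i => ∏ r ∈ blocks n m i, ξ r)
      = fun j : Fin (m + 1) => walk ξ (n * j / m) := by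
  refine eq_cumProd (by simp [blocks, walk]) fun i => ?_
  have h := natDiv_mono n m (Nat.le_succ (i : ℕ))
  have hw := walk_add ξ (n * i / m) (n * (i + 1) / m - n * i / m)
  rw [Nat.add_sub_cancel' h] at hw
  simp only [blocks, Fin.cons_succ, Fin.val_succ, Fin.val_castSucc]
  exact hw.symm

theorem integral_torusChar_blocks (β : ℝ) (n m : ℕ) (k : Fin (m + 1) → ℤ) :
    ∫ ξ, torusChar k (fun i => ∏ r ∈ blocks n m i, ξ r) ∂(steps β)
      = (∫ z, ((z ^ k 0 : Circle) : ℂ) ∂uniformSpin)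
        * ∏ i : Fin m, vonMisesCoeff β (k i.succ) ^ (n * (i + 1) / m - n * i / m) := by
  rw [integral_prod_blocks β (pairwise_disjoint_blocks n m), Fin.prod_univ_succ]
  congr 1
  · simp [blocks, stepLaw]
  · refine Finset.prod_congr rfl fun i _ => ?_
    simp only [blocks, Fin.cons_succ]
    rw [← Nat.card_Ioc, ← Finset.prod_const]
    refine Finset.prod_congr rfl fun r hr => ?_
    rw [stepLaw, if_neg (Nat.zero_lt_of_lt (Finset.mem_Ioc.1 hr).1).ne', vonMisesCoeff]

theorem tendsto_blockLength_div {m : ℕ} (hm : 0 < m) (i : ℕ) :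
    Tendsto (fun n : ℕ => ((n * (i + 1) / m - n * i / m : ℕ) : ℝ) / n) atTop (𝓝 (1 / m)) := by
  have h := (tendsto_natDiv_div (i + 1) hm).sub (tendsto_natDiv_div i hm)
  rw [show ((i + 1 : ℕ) : ℝ) / m - i / m = 1 / m by push_cast; ring] at h
  refine h.congr fun n => ?_
  rw [Nat.cast_sub (natDiv_mono n m (Nat.le_succ i)), sub_div]

/-- The walk at grid times approximates the path of the chain. -/
theorem edist_spinPath_le {n m : ℕ} {ε : ℝ} {ξ : ℕ → Circle} (hξ : ξ ∉ oscillates n m ε) :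
    edist (spinPath n fun j => walk ξ j) (spinPath m fun j => walk ξ (n * j / m))
      ≤ ENNReal.ofReal (2 * ε) := by
  refine CadlagPath.edist_le_of_forall_edist_le fun t => ?_
  rw [edist_dist]
  exact ENNReal.ofReal_le_ofReal (not_lt.1 fun h => hξ ⟨t, h⟩)

theorem measurable_walk (k : ℕ) : Measurable fun ξ : ℕ → Circle => walk ξ k :=
  measurable_prod_block _

/-- Starting point and grid increments of the limiting path. -/
def limitBlocks {Ω' : Type*} (Φ : I → Ω' → ℝ) (m : ℕ) (ω : Ω') : Fin (m + 1) → Circle :=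
  Fin.cons (Circle.exp (Φ 0 ω)) (gridIncrement m fun t => Circle.exp (Φ t ω - Φ 0 ω))

theorem cumProd_limitBlocks {Ω' : Type*} {Φ : I → Ω' → ℝ} {S : Ω' → CadlagPath Circle} {ω : Ω'}
    (hω : ∀ t : I, S ω t = Circle.exp (Φ t ω)) (m : ℕ) :
    cumProd (m + 1) (limitBlocks Φ m ω) = fun j => S ω (gridPoint m j) := by
  refine eq_cumProd ?_ fun i => ?_
  · have : gridPoint m 0 = 0 := Subtype.ext (by simp [gridPoint])
    simp [limitBlocks, hω, this]
  · simp only [limitBlocks, Fin.cons_succ, gridIncrement, hω, ← Circle.exp_sub, ← Circle.exp_add]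
    congr 1; ring

section Limit

variable {Ω : Type*} [MeasurableSpace Ω] {P : Measure Ω} {B : NNReal → Ω → ℝ} {b : ℝ}
  {Ω' : Type*} [MeasurableSpace Ω'] {P' : Measure Ω'} {Φ : I → Ω' → ℝ} {S : Ω' → CadlagPath Circle}

/-- Brownian continuity transfers through the law of exp(i(Φ(t) - Φ(0))) as uniform continuity at
rational times. Multiplying by exp(iΦ(0)) is an isometry, and the càdlàg property of S extends the
conclusion to all times. -/
theorem ae_continuous_limit (hB : IsBrownianReal B P)
    (hS : ∀ᵐ ω ∂P', ∀ t : I, S ω t = Circle.exp (Φ t ω))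
    (hΦ_law : IdentDistrib (fun ω (t : I) => Circle.exp (Φ t ω - Φ 0 ω))
      (fun ω (t : I) => Circle.exp (B (unitInterval.toNNReal t) ω / √b)) P' P) :
    ∀ᵐ ω ∂P', Continuous (S ω).toFun := by
  have hBmem : ∀ᵐ ω ∂P, (fun t : I => Circle.exp (B (unitInterval.toNNReal t) ω / √b))
      ∈ CadlagPath.ratUniform Circle := by
    filter_upwards [hB.cont] with ω hω
    refine CadlagPath.mem_ratUniform_of_continuous (Circle.exp.continuous.comp
      ((hω.comp unitInterval.toNNReal_continuous).div_const _))
  filter_upwards [hS, hΦ_law.symm.ae_mem_snd (CadlagPath.measurableSet_ratUniform Circle) hBmem]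
    with ω hω hmem
  refine CadlagPath.continuous_of_mem_ratUniform fun p => ?_
  obtain ⟨q, hq⟩ := hmem p
  refine ⟨q, fun s hs t ht hst => ?_⟩
  have h := hq s hs t ht hst
  rwa [← dist_circle_mul_right _ _ (Circle.exp (Φ 0 ω)), ← Circle.exp_add, ← Circle.exp_add,
    sub_add_cancel, sub_add_cancel, ← hω, ← hω] at h

theorem aemeasurable_limitBlocks
    (hΦ_zero : pdf.IsUniform (Φ 0) (Ico (-Real.pi) Real.pi) P' volume)
    (hΦ : AEMeasurable (fun ω (t : I) => Circle.exp (Φ t ω - Φ 0 ω)) P') (m : ℕ) :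
    AEMeasurable (limitBlocks Φ m) P' := by
  have h0 := hΦ_zero.aemeasurable (by simp [Real.pi_pos]) (by simp)
  refine aemeasurable_pi_lambda _ (Fin.cases ?_ fun i => ?_)
  · exact Circle.exp.continuous.measurable.comp_aemeasurable h0
  · exact (measurable_gridIncrement m i).comp_aemeasurable hΦ

theorem integral_torusChar_limitBlocks [IsProbabilityMeasure P] (hb : 0 < b)
    (hB : IsBrownianReal B P)
    (hΦ_zero : pdf.IsUniform (Φ 0) (Ico (-Real.pi) Real.pi) P' volume)
    (hΦ_indep : IndepFun (Φ 0) (fun ω (t : I) => Circle.exp (Φ t ω - Φ 0 ω)) P')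
    (hΦ_law : IdentDistrib (fun ω (t : I) => Circle.exp (Φ t ω - Φ 0 ω))
      (fun ω (t : I) => Circle.exp (B (unitInterval.toNNReal t) ω / √b)) P' P)
    {m : ℕ} (k : Fin (m + 1) → ℤ) :
    ∫ ω, torusChar k (limitBlocks Φ m ω) ∂P'
      = (∫ z, ((z ^ k 0 : Circle) : ℂ) ∂uniformSpin)
        * ∏ i : Fin m, Complex.exp (-((k i.succ : ℂ) ^ 2 * ((1 / m : ℝ) : ℂ) / (2 * b))) := by
  have h0 := hΦ_zero.aemeasurable (by simp [Real.pi_pos]) (by simp)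
  have hφ : Continuous fun x : ℝ => ((Circle.exp x ^ k 0 : Circle) : ℂ) :=
    (continuous_circle_zpow (k 0)).comp (by fun_prop)
  have hψ := measurable_torusChar_gridIncrement m fun i => k i.succ
  have hind := hΦ_indep.comp hφ.measurable hψ
  have h1 := hind.integral_fun_mul_eq_mul_integral
    (hφ.measurable.comp_aemeasurable h0).aestronglyMeasurable
    (hψ.comp_aemeasurable hΦ_law.aemeasurable_fst).aestronglyMeasurable
  have h2 := (hΦ_law.comp hψ).integral_eq
  simp only [Function.comp_apply] at h1 h2
  rw [h2, integral_torusChar_brownian hB hb] at h1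
  have hexp : AEMeasurable (fun ω => Circle.exp (Φ 0 ω)) P' :=
    Circle.exp.continuous.measurable.comp_aemeasurable h0
  rw [← map_circle_exp_of_isUniform hΦ_zero, integral_map hexp
    (continuous_circle_zpow (k 0)).aestronglyMeasurable, ← h1]
  congr 1; ext ω
  rw [torusChar_eq_prod, torusChar_eq_prod, Fin.prod_univ_succ]
  simp [limitBlocks]

/-- Convergence of the finite-dimensional distributions. -/
theorem tendsto_integral_blocks [IsProbabilityMeasure P] [IsProbabilityMeasure P'] {β : ℕ → ℝ}
    (hb : 0 < b)
    (hβ : Tendsto (fun n : ℕ => β n / (n : ℝ)) atTop (𝓝 b)) (hB : IsBrownianReal B P)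
    (hΦ_zero : pdf.IsUniform (Φ 0) (Ico (-Real.pi) Real.pi) P' volume)
    (hΦ_indep : IndepFun (Φ 0) (fun ω (t : I) => Circle.exp (Φ t ω - Φ 0 ω)) P')
    (hΦ_law : IdentDistrib (fun ω (t : I) => Circle.exp (Φ t ω - Φ 0 ω))
      (fun ω (t : I) => Circle.exp (B (unitInterval.toNNReal t) ω / √b)) P' P)
    {m : ℕ} (hm : 0 < m) {g : (Fin (m + 1) → Circle) → ℝ} (hg : Continuous g) :
    Tendsto (fun n => ∫ ξ, g (fun i => ∏ r ∈ blocks n m i, ξ r) ∂(steps (β n))) atTop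
      (𝓝 (∫ ω, g (limitBlocks Φ m ω) ∂P')) := by
  have hY : ∀ n, Measurable fun (ξ : ℕ → Circle) (i : Fin (m + 1)) => ∏ r ∈ blocks n m i, ξ r :=
    fun n => measurable_pi_iff.2 fun i => measurable_prod_block _
  have hL := aemeasurable_limitBlocks hΦ_zero hΦ_law.aemeasurable_fst m
  have h1 : ∀ n, IsProbabilityMeasure ((steps (β n)).map
      fun (ξ : ℕ → Circle) (i : Fin (m + 1)) => ∏ r ∈ blocks n m i, ξ r) := fun n =>
    Measure.isProbabilityMeasure_map (hY n).aemeasurable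
  have h2 : IsProbabilityMeasure (P'.map (limitBlocks Φ m)) := Measure.isProbabilityMeasure_map hL
  have h := tendsto_integral_real_of_tendsto_torusChar (l := atTop)
    (μ := fun n => (steps (β n)).map
      fun (ξ : ℕ → Circle) (i : Fin (m + 1)) => ∏ r ∈ blocks n m i, ξ r)
    (ν := P'.map (limitBlocks Φ m)) (fun k => ?_) hg
  · rw [integral_map hL hg.aestronglyMeasurable] at h
    exact h.congr fun n => integral_map (hY n).aemeasurable hg.aestronglyMeasurable
  · rw [integral_map hL (torusChar k).continuous.aestronglyMeasurable,
      integral_torusChar_limitBlocks hb hB hΦ_zero hΦ_indep hΦ_law]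
    refine Tendsto.congr (fun n => ((integral_map (hY n).aemeasurable
      (torusChar k).continuous.aestronglyMeasurable).trans
      (integral_torusChar_blocks (β n) n m k)).symm) ?_
    -- The factor of the uniform starting spin is the same on both sides and never has to be
    -- evaluated.
    refine Tendsto.const_mul _ (tendsto_finsetProd _ fun i _ => ?_)
    exact tendsto_vonMisesCoeff_pow hb hβ (k i.succ) (tendsto_blockLength_div hm i)

end Limit

end XYChain

end

open XYChain

/-! ### Convergence in distribution. -/

theorem mainTheorem8 (β : ℕ → ℝ) (b : ℝ) (hb : 0 < b)
    (hβ : Tendsto (fun n : ℕ => β n / (n : ℝ)) atTop (𝓝 b))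
    -- a standard one-dimensional Brownian motion
    {Ω : Type*} [MeasurableSpace Ω] (P : Measure Ω) [IsProbabilityMeasure P]
    (B : NNReal → Ω → ℝ) (hB : IsBrownianReal B P)
    -- the limiting angle process `Φ` and the càdlàg spin process `S = e^{iΦ}`
    {Ω' : Type*} [MeasurableSpace Ω'] (P' : Measure Ω') [IsProbabilityMeasure P']
    (Φ : I → Ω' → ℝ) (S : Ω' → CadlagPath Circle)
    (hS : ∀ᵐ ω ∂P', ∀ t : I, S ω t = Circle.exp (Φ t ω))
    (hΦ_zero : pdf.IsUniform (Φ 0) (Ico (-Real.pi) Real.pi) P' volume)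
    (hΦ_indep : IndepFun (Φ 0) (fun ω (t : I) => Circle.exp (Φ t ω - Φ 0 ω)) P')
    (hΦ_law : IdentDistrib (fun ω (t : I) => Circle.exp (Φ t ω - Φ 0 ω))
      (fun ω (t : I) => Circle.exp (B (unitInterval.toNNReal t) ω / √b)) P' P) :
    TendstoInDistribution (fun n : ℕ => XYChain.spinPath n) atTop S
      (fun n : ℕ => XYChain.gibbs n (β n)) P' := by
  have hcont := ae_continuous_limit hB hS hΦ_law
  have hsp : ∀ m, Continuous (spinPath m) := fun m => (lipschitzWith_spinPath m).continuous
  let X (m : ℕ) (ω : Ω') : CadlagPath Circle := spinPath m (cumProd (m + 1) (limitBlocks Φ m ω))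
  have hXm : ∀ m, AEMeasurable (X m) P' := fun m =>
    ((hsp m).comp (continuous_cumProd (m + 1))).measurable.comp_aemeasurable
      (aemeasurable_limitBlocks hΦ_zero hΦ_law.aemeasurable_fst m)
  have hXlim : ∀ᵐ ω ∂P', Tendsto (fun m => X m ω) atTop (𝓝 (S ω)) := by
    filter_upwards [hS, hcont] with ω hω hc
    simp only [X, cumProd_limitBlocks hω]
    exact tendsto_spinPath_gridPoint hc
  -- Measurability of S in the Skorohod space is not assumed; it follows from almost sure
  -- approximation by measurable interpolations.
  have hSm : AEMeasurable S P' := aemeasurable_of_tendsto_metrizable_ae atTop hXm hXlim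
  refine ⟨fun n => (hsp n).measurable.aemeasurable, hSm, ?_⟩
  refine tendsto_iff_forall_lipschitz_integral_tendsto.2 ?_
  rintro f ⟨C, hC⟩ ⟨K, hK⟩
  have hfc := hK.continuous
  have hfm := hfc.measurable
  have hC0 : 0 ≤ C := dist_nonneg.trans (hC (spinPath 0 1) (spinPath 0 1))
  have hfb : ∀ x, ‖f x‖ ≤ ‖f (spinPath 0 1)‖ + C := fun x => by
    have h1 := hC x (spinPath 0 1)
    rw [dist_eq_norm] at h1
    linarith [norm_sub_norm_le (f x) (f (spinPath 0 1))]
  have hW : ∀ n, Measurable fun (ξ : ℕ → Circle) (j : Fin (n + 1)) => walk ξ j := fun n =>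
    measurable_pi_iff.2 fun j => measurable_walk j
  have hleft : ∀ n, ∫ x, f x ∂((gibbs n (β n)).map (spinPath n))
      = ∫ ξ, f (spinPath n fun j => walk ξ j) ∂(steps (β n)) := fun n => by
    rw [integral_map (hsp n).measurable.aemeasurable hfm.aestronglyMeasurable, gibbs_eq_map_walk,
      integral_map (f := fun x => f (spinPath n x)) (hW n).aemeasurable
        (hfm.comp (hsp n).measurable).aestronglyMeasurable]
  simp only [ProbabilityMeasure.coe_mk]
  simp_rw [hleft]
  rw [integral_map hSm hfm.aestronglyMeasurable]
  have hB' : Tendsto (fun m => ∫ ω, f (X m ω) ∂P') atTop (𝓝 (∫ ω, f (S ω) ∂P')) := by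
    refine tendsto_integral_of_dominated_convergence (fun _ => ‖f (spinPath 0 1)‖ + C)
      (fun m => (hfm.comp_aemeasurable (hXm m)).aestronglyMeasurable) (integrable_const _)
      (fun m => Eventually.of_forall fun ω => hfb _) ?_
    filter_upwards [hXlim] with ω hω
    exact (hfc.tendsto _).comp hω
  rw [Metric.tendsto_nhds]
  intro η hη
  -- The error η is split into quarters: the Lipschitz bound off the oscillation event (2Kε), the
  -- bound on that event (Cδ), the convergence of the grid variables, and the interpolation of the
  -- limit. The added 1 avoids dividing by zero.
  set ε : ℝ := η / (8 * (K + 1)) with hε_def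
  set δ : ℝ := η / (4 * (C + 1)) with hδ_def
  have hε : 0 < ε := by positivity
  have hδ : 0 < δ := by positivity
  have hKε : K * (2 * ε) ≤ η / 4 := by
    have : K * (2 * ε) = η / 4 * (K / (K + 1)) := by rw [hε_def]; field_simp; ring
    rw [this]
    exact mul_le_of_le_one_right (by positivity) (div_le_one_of_le₀ (by linarith) (by positivity))
  have hCδ : C * δ ≤ η / 4 := by
    have : C * δ = η / 4 * (C / (C + 1)) := by rw [hδ_def]; field_simp
    rw [this]
    exact mul_le_of_le_one_right (by positivity) (div_le_one_of_le₀ (by linarith) (by positivity))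
  -- The grid size m is fixed before n tends to infinity.
  obtain ⟨m, hm, hmX, hm0⟩ := ((eventually_measureReal_oscillates_lt hb hβ hε hδ).and
    ((Metric.tendsto_nhds.1 hB' (η / 4) (by positivity)).and (eventually_gt_atTop 0))).exists
  have hfdd := tendsto_integral_blocks hb hβ hB hΦ_zero hΦ_indep hΦ_law hm0
    (hfc.comp ((hsp m).comp (continuous_cumProd (m + 1))))
  filter_upwards [hm, Metric.tendsto_nhds.1 hfdd (η / 4) (by positivity)] with n hn hn2
  simp only [Function.comp_apply, walk_eq_cumProd_blocks] at hn2
  have hgm : Measurable fun ξ : ℕ → Circle => f (spinPath n fun j => walk ξ j) :=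
    hfm.comp ((hsp n).measurable.comp (hW n))
  have hgm' : Measurable fun ξ : ℕ → Circle =>
      f (spinPath m fun j => walk ξ (n * (j : ℕ) / m)) :=
    hfm.comp ((hsp m).measurable.comp (measurable_pi_iff.2 fun j => measurable_walk _))
  have hclose : dist (∫ ξ, f (spinPath n fun j => walk ξ j) ∂(steps (β n)))
      (∫ ξ, f (spinPath m fun j => walk ξ (n * (j : ℕ) / m)) ∂(steps (β n)))
      ≤ K * (2 * ε) + C * (steps (β n)).real (oscillates n m ε) := by
    rw [Real.dist_eq, ← integral_sub
      (Integrable.of_bound hgm.aestronglyMeasurable _ (Eventually.of_forall fun _ => hfb _))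
      (Integrable.of_bound hgm'.aestronglyMeasurable _ (Eventually.of_forall fun _ => hfb _))]
    refine abs_integral_le_add_mul_measureReal (by positivity) (fun ξ hξ => ?_)
      fun ξ => hC _ _
    have h1 := (hK _ _).trans (mul_le_mul_right (edist_spinPath_le hξ) (K : ℝ≥0∞))
    rw [edist_dist, ← ENNReal.ofReal_coe_nnreal, ← ENNReal.ofReal_mul (by positivity),
      ENNReal.ofReal_le_ofReal_iff (by positivity)] at h1
    exact h1
  have h4 : C * (steps (β n)).real (oscillates n m ε) ≤ C * δ := by gcongr
  have h5 := dist_triangle4 (∫ ξ, f (spinPath n fun j => walk ξ j) ∂(steps (β n)))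
    (∫ ξ, f (spinPath m fun j => walk ξ (n * (j : ℕ) / m)) ∂(steps (β n)))
    (∫ ω, f (X m ω) ∂P') (∫ ω, f (S ω) ∂P')
  linarith
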